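/- Let $k$ be a commutative ring. A correspondence functor is a functor from the category of finite sets and correspondences (morphisms $X\to Y$ are the subsets of $Y\times X$, with the usual composition of relations) to $k$-modules, and its dual is $F^\natural(X)=\operatorname{Hom}_k(F(X),k)$, with $F^\natural(Q)(\alpha)=\alpha\circ F(Q^{op})$. For a nonempty finite lattice $T$, let $F_T$ be the correspondence functor for which $F_T(X)$ is the free $k$-module on the set of maps $X\to T$ and $(Q\varphi)(y)=\bigvee_{(y,x)\in Q}\varphi(x)$ for $Q\subseteq Y\times X$. For every finite set $X$ there is a bilinear form $(-,-)_X:F_T(X)\times F_{T^{op}}(X)\to k$ with $(\varphi,\psi)_X=1$ if $\varphi(x)\le_T\psi(x)$ for all $x\in X$, and $(\varphi,\psi)_X=0$ otherwise; orthogonals $\perp$ of subfunctors are taken with respect to these forms. For a finite set $E$, let $\mathcal P_E$ be the quotient of the $k$-algebra of relations on $E$ by the two-sided ideal generated by the relations that factor through a set of cardinality smaller than $|E|$ and by the differences $Q-\overline Q$, where $Q$ is a reflexive relation and $\overline Q$ its transitive closure. For an order $R$ on $E$, let $f_R=\sum_{S\supseteq R}\mu(R,S)\,S\in\mathcal P_E$,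 where $S$ runs through the orders on $E$ containing $R$ and $\mu$ is the Möbius function of the set of orders on $E$ ordered by inclusion. The fundamental functor is $\mathbb S_{E,R}=L/J$, where $L(X)=k\mathcal C(X,E)\otimes_{k\mathcal C(E,E)}\mathcal P_Ef_R$ with $\mathcal C(X,E)$ the set of subsets of $X\times E$, and $J(X)$ consists of the elements $\sum_i\phi_i\otimes w_i$ with $\sum_i(\psi\phi_i)w_i=0$ for all $\psi\in\mathcal C(E,X)$. An element $w\in\mathcal P_Ef_R$ is viewed as an element of $\mathbb S_{E,R}(E)$, namely the class of $\operatorname{id}_E\otimes w$. For a permutation $\sigma$ of $E$ put $\Delta_\sigma=\{(\sigma(x),x)\mid x\in E\}$. Theorem. Let $T$ be a nonempty finite lattice, let $(E,R)$ be its full subposet of join-irreducible elements, and let $\iota:E\to T$ be the inclusion. For $e\in E$ let $r(e)$ be the join of all elements $s<e$ of $T$; for $A\subseteq E$ let $\eta_A:E\to T$ be the map with $\eta_A(e)=r(e)$ if $e\in A$ and $\eta_A(e)=e$ otherwise; let $\gamma_T=\sum_{A\subseteq E}(-1)^{|A|}\eta_A\in F_{T^{op}}(E)$, and let $\langle\gamma_T\rangle$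 be the subfunctor of $F_{T^{op}}$ generated by $\gamma_T$. There is a unique morphism $\Theta_T:F_T\to\mathbb S_{E,R^{op}}$ with $\Theta_T(\iota)=f_{R^{op}}$, and the following hold. (a) $\langle\gamma_T\rangle^\perp=\ker\Theta_T$. (b) $\Theta_T$ induces an isomorphism $F_T/\langle\gamma_T\rangle^\perp\cong\mathbb S_{E,R^{op}}$. (c) There is an isomorphism $j:\langle\gamma_T\rangle^{\perp\perp}\to\mathbb S_{E,R^{op}}^\natural$ such that $j(w)(\Theta_T(a))=(a,w)_X$ for every finite set $X$, all $a\in F_T(X)$ and all $w\in\langle\gamma_T\rangle^{\perp\perp}(X)$. (d) There is a canonical injective morphism $\alpha_{E,R}:\mathbb S_{E,R}\to\mathbb S_{E,R^{op}}^\natural$: there is an isomorphism $\beta:\mathbb S_{E,R}\to\langle\gamma_T\rangle$ with $\beta(f_R)=\gamma_T$, the composite $\alpha_{E,R}$ of $\beta$, the inclusion $\langle\gamma_T\rangle\subseteq\langle\gamma_T\rangle^{\perp\perp}$ and $j$ is injective (at every finite set), and $\alpha_{E,R}$ is the unique morphism $\mathbb S_{E,R}\to\mathbb S_{E,R^{op}}^\natural$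 for which the linear form $\alpha_{E,R}(f_R)$ takes the value $1$ on $f_{R^{op}}$ and $0$ on $\Delta_\sigma f_{R^{op}}$ for every permutation $\sigma\neq1$ of $E$. -/

import Mathlib

open CategoryTheory

universe u v

noncomputable section

namespace CorrFun

/-! ### Finite sets, correspondences, correspondence functors -/

/-- Finite sets, the objects of the category of correspondences. -/
structure FinCorr : Type (u + 1) where
  carrier : Type u
  [fin : Finite carrier]

instance : CoeSort FinCorr.{u} (Type u) := ⟨FinCorr.carrier⟩

instance (X : FinCorr.{u}) : Finite X := X.fin

/-- A correspondence from `X` to `Y` is a subset of `Y × X`. -/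
@[ext]
structure Corr (X Y : FinCorr.{u}) : Type u where
  rel : SetRel Y X

/-- For `S ⊆ Y × X` and `R ⊆ Z × Y`, the composite `S ≫ R` is the correspondence
`R S = {(z, x) | ∃ y, (z, y) ∈ R ∧ (y, x) ∈ S}`. -/
instance : Category.{u} FinCorr.{u} where
  Hom := Corr
  id X := ⟨{p | p.1 = p.2}⟩
  comp S R := ⟨{p | ∃ y, (p.1, y) ∈ R.rel ∧ (y, p.2) ∈ S.rel}⟩
  id_comp f := by
    apply Corr.ext; ext ⟨a, b⟩; simp
  comp_id f := by
    apply Corr.ext; ext ⟨a, b⟩; simp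
  assoc f g h := by
    apply Corr.ext; ext ⟨a, b⟩
    constructor
    · rintro ⟨y, h1, z, h2, h3⟩
      exact ⟨z, ⟨y, h1, h2⟩, h3⟩
    · rintro ⟨z, ⟨y, h1, h2⟩, h3⟩
      exact ⟨y, h1, z, h2, h3⟩

/-- The morphism of the category given by a subset of `Y × X`. -/
def toHom {X Y : FinCorr.{u}} (R : SetRel Y X) : X ⟶ Y := Corr.mk R

/-- The subset of `Y × X` underlying a morphism `X ⟶ Y`. -/
def relOf {X Y : FinCorr.{u}} (R : X ⟶ Y) : SetRel Y X := Corr.rel R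

/-- The opposite correspondence. -/
def opCorr {X Y : FinCorr.{u}} (R : X ⟶ Y) : Y ⟶ X := toHom (relOf R).inv

/-- The opposite, as a functor. -/
def opFunctor : FinCorr.{u}ᵒᵖ ⥤ FinCorr.{u} where
  obj X := X.unop
  map f := opCorr f.unop
  map_id X := by
    apply Corr.ext; ext ⟨a, b⟩
    exact eq_comm
  map_comp f g := by
    apply Corr.ext; ext ⟨a, b⟩
    constructor
    · rintro ⟨y, h1, h2⟩; exact ⟨y, h2, h1⟩
    · rintro ⟨y, h1, h2⟩; exact ⟨y, h2, h1⟩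

/-- Correspondence functors over `k`: functors from finite sets and correspondences to
`k`-modules (equivalently `k`-linear functors on the `k`-linearization of that category). -/
abbrev CorrFunctor (k : Type v) [CommRing k] :=
  FinCorr.{u} ⥤ ModuleCat.{max u v} k

variable {k : Type v} [CommRing k]

/-! ### Subfunctors and quotients -/

/-- A subfunctor of a correspondence functor. -/
@[ext]
structure Sub (F : CorrFunctor.{u} k) where
  obj : (X : FinCorr.{u}) → Submodule k (F.obj X)
  map_mem : ∀ {X Y : FinCorr.{u}} (Q : X ⟶ Y) (x : F.obj X), x ∈ obj X → F.map Q x ∈ obj Y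

namespace Sub

variable {F : CorrFunctor.{u} k}

/-- A subfunctor, as a correspondence functor. -/
def toFunctor (G : Sub F) : CorrFunctor.{u} k where
  obj X := ModuleCat.of k (G.obj X)
  map {X Y} Q := ModuleCat.ofHom ((F.map Q).hom.restrict (fun x hx => G.map_mem Q x hx))
  map_id X := by
    apply ModuleCat.hom_ext
    refine LinearMap.ext fun x => Subtype.ext ?_
    change F.map (𝟙 X) x.1 = x.1
    simp
  map_comp f g := by
    apply ModuleCat.hom_ext
    refine LinearMap.ext fun x => Subtype.ext ?_
    change F.map (f ≫ g) x.1 = F.map g (F.map f x.1)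
    simp

/-- The inclusion of a subfunctor. -/
def incl (G : Sub F) : G.toFunctor ⟶ F where
  app X := ModuleCat.ofHom (G.obj X).subtype
  naturality X Y f := by ext x; rfl

/-- The inclusion between two nested subfunctors. -/
def inclusion {G H : Sub F} (h : ∀ X, G.obj X ≤ H.obj X) : G.toFunctor ⟶ H.toFunctor where
  app X := ModuleCat.ofHom (Submodule.inclusion (h X))
  naturality X Y f := by ext x; rfl

/-- The quotient functor `F / G`. -/
def quot (G : Sub F) : CorrFunctor.{u} k where
  obj X := ModuleCat.of k (F.obj X ⧸ G.obj X)
  map {X Y} Q := ModuleCat.ofHom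
    ((G.obj X).mapQ (G.obj Y) (F.map Q).hom (fun x hx => G.map_mem Q x hx))
  map_id X := by
    ext x
    simp
  map_comp f g := by
    ext x
    simp

/-- The projection `F → F / G`. -/
def proj (G : Sub F) : F ⟶ G.quot where
  app X := ModuleCat.ofHom (G.obj X).mkQ
  naturality X Y f := by ext x; rfl

/-- The kernel of a morphism of correspondence functors. -/
def ker {F' : CorrFunctor.{u} k} (θ : F ⟶ F') : Sub F where
  obj X := LinearMap.ker (θ.app X).hom
  map_mem Q x hx := by
    have hx' : θ.app _ x = 0 := hx
    have := congrArg (fun f => f.hom x) (θ.naturality Q)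
    simp only [ModuleCat.hom_comp, LinearMap.comp_apply] at this
    change θ.app _ (F.map Q x) = 0
    change θ.app _ (F.map Q x) = F'.map Q (θ.app _ x) at this
    rw [this, hx', map_zero]

/-- The subfunctor generated by an element `γ ∈ F(E)`. -/
def gen {E : FinCorr.{u}} (γ : F.obj E) : Sub F where
  obj X := Submodule.span k (Set.range fun Q : E ⟶ X => F.map Q γ)
  map_mem {X Y} Q x hx := by
    have : Submodule.span k (Set.range fun P : E ⟶ X => F.map P γ) ≤
        (Submodule.span k (Set.range fun P : E ⟶ Y => F.map P γ)).comap (F.map Q).hom := by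
      rw [Submodule.span_le]
      rintro _ ⟨P, rfl⟩
      refine Submodule.subset_span ⟨P ≫ Q, ?_⟩
      simp
    exact this hx

lemma mem_gen {E : FinCorr.{u}} (γ : F.obj E) : γ ∈ (gen γ).obj E :=
  Submodule.subset_span ⟨𝟙 E, by simp⟩

/-- `gen γ` is the smallest subfunctor containing `γ`. -/
lemma gen_le {E : FinCorr.{u}} (γ : F.obj E) (G : Sub F) (h : γ ∈ G.obj E) (X : FinCorr.{u}) :
    (gen γ).obj X ≤ G.obj X := by
  refine Submodule.span_le.2 ?_
  rintro _ ⟨P, rfl⟩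
  exact G.map_mem P γ h

end Sub

/-- The dual functor: `F^♮(X) = Hom_k(F(X), k)`, with `F^♮(R)(α) = α ∘ F(R^op)`. -/
def dual (F : CorrFunctor.{u} k) : CorrFunctor.{u} k where
  obj X := ModuleCat.of k (Module.Dual k (F.obj X))
  map R := ModuleCat.ofHom (F.map (opCorr R)).hom.dualMap
  map_id X := by
    have : opCorr (𝟙 X) = 𝟙 X := opFunctor.map_id (Opposite.op X)
    apply ModuleCat.hom_ext
    refine LinearMap.ext fun α => LinearMap.ext fun x => ?_
    change α (F.map (opCorr (𝟙 X)) x) = α x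
    rw [this]
    simp
  map_comp {X Y Z} f g := by
    have : opCorr (f ≫ g) = opCorr g ≫ opCorr f := opFunctor.map_comp g.op f.op
    apply ModuleCat.hom_ext
    refine LinearMap.ext fun α => LinearMap.ext fun x => ?_
    change α (F.map (opCorr (f ≫ g)) x) = α (F.map (opCorr f) (F.map (opCorr g) x))
    rw [this]
    simp

/-- The value at `x ∈ F(X)` of a linear form `α ∈ F^♮(X)`. -/
def dualApply {F : CorrFunctor.{u} k} {X : FinCorr.{u}} (α : (dual F).obj X) (x : F.obj X) : k :=
  (show Module.Dual k (F.obj X) from α) x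

/-! ### The functors `L_{E,W}` and `J_{E,W}`

A module over the algebra `k𝒞(E,E)` is given by a representation of the monoid `End E = 𝒞(E,E)`
(whose product is the composition `Q * Q' = Q Q'` of relations). -/

section LJ

variable {E : FinCorr.{u}} {W : Type max u v} [AddCommGroup W] [Module k W]
  (ρ : Representation k (End E) W)

/-- The submodule of `k𝒞(X,E) ⊗_k W` spanned by all `φα ⊗ w - φ ⊗ αw`. Since `k𝒞(X,E)` is free
on `𝒞(X,E)`, the tensor product over `k` is the direct sum of copies of `W` indexed by `𝒞(X,E)`,
and `φ ⊗ w` is `Finsupp.single φ w`. -/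
def balanced (X : FinCorr.{u}) : Submodule k ((E ⟶ X) →₀ W) :=
  Submodule.span k {t | ∃ (φ : E ⟶ X) (α : End E) (w : W),
    t = Finsupp.single (α ≫ φ) w - Finsupp.single φ (ρ α w)}

/-- Composition with `Q`, as a linear map `k𝒞(X,E) ⊗_k W → k𝒞(Y,E) ⊗_k W`. -/
def postcomp (k : Type v) [CommRing k] (E : FinCorr.{u}) (W : Type max u v) [AddCommGroup W]
    [Module k W] {X Y : FinCorr.{u}} (Q : X ⟶ Y) : ((E ⟶ X) →₀ W) →ₗ[k] ((E ⟶ Y) →₀ W) :=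
  Finsupp.lmapDomain W k (fun φ : E ⟶ X => φ ≫ Q)

lemma postcomp_single {X Y : FinCorr.{u}} (Q : X ⟶ Y) (φ : E ⟶ X) (w : W) :
    postcomp k E W Q (Finsupp.single φ w) = Finsupp.single (φ ≫ Q) w := by
  simp [postcomp]

lemma balanced_le {X Y : FinCorr.{u}} (Q : X ⟶ Y) :
    balanced ρ X ≤ (balanced ρ Y).comap (postcomp k E W Q) := by
  refine Submodule.span_le.2 ?_
  rintro _ ⟨φ, α, w, rfl⟩
  refine Submodule.subset_span ⟨φ ≫ Q, α, w, ?_⟩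
  rw [map_sub, postcomp_single, postcomp_single, Category.assoc]

/-- `L_{E,W}(X) = k𝒞(X,E) ⊗_{k𝒞(E,E)} W`. -/
def LFun : CorrFunctor.{u} k where
  obj X := ModuleCat.of k (((E ⟶ X) →₀ W) ⧸ balanced ρ X)
  map {X Y} Q := ModuleCat.ofHom
    ((balanced ρ X).mapQ (balanced ρ Y) (postcomp k E W Q) (balanced_le ρ Q))
  map_id X := by
    apply ModuleCat.hom_ext
    refine Submodule.linearMap_qext _ (Finsupp.lhom_ext fun φ w => ?_)
    simp [postcomp_single]
  map_comp f g := by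
    apply ModuleCat.hom_ext
    refine Submodule.linearMap_qext _ (Finsupp.lhom_ext fun φ w => ?_)
    simp [postcomp_single]

/-- The element `φ ⊗ w` of `L_{E,W}(X)`. -/
def LFun.tmul {X : FinCorr.{u}} (φ : E ⟶ X) (w : W) : (LFun ρ).obj X :=
  (balanced ρ X).mkQ (Finsupp.single φ w)

/-- The linear map `k𝒞(X,E) ⊗_k W → W`, `φ ⊗ w ↦ (ψφ) w`, for `ψ ∈ 𝒞(E,X)`. -/
def preEval {X : FinCorr.{u}} (ψ : X ⟶ E) : ((E ⟶ X) →₀ W) →ₗ[k] W :=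
  Finsupp.lsum k (fun φ : E ⟶ X => (ρ (φ ≫ ψ : E ⟶ E) : W →ₗ[k] W))

lemma preEval_single {X : FinCorr.{u}} (ψ : X ⟶ E) (φ : E ⟶ X) (w : W) :
    preEval ρ ψ (Finsupp.single φ w) = ρ (φ ≫ ψ : E ⟶ E) w :=
  Finsupp.lsum_single k _ φ w

lemma balanced_le_ker {X : FinCorr.{u}} (ψ : X ⟶ E) :
    balanced ρ X ≤ LinearMap.ker (preEval ρ ψ) := by
  refine Submodule.span_le.2 ?_
  rintro _ ⟨φ, α, w, rfl⟩
  have h : ρ ((α ≫ φ) ≫ ψ : E ⟶ E) = ρ (φ ≫ ψ : E ⟶ E) * ρ α := by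
    rw [← map_mul]
    exact congrArg ρ (Category.assoc α φ ψ)
  simp only [SetLike.mem_coe, LinearMap.mem_ker, map_sub, preEval_single]
  rw [h, Module.End.mul_apply, sub_self]

/-- For `ψ ∈ 𝒞(E,X)`, the linear map `L_{E,W}(X) → W`, `φ ⊗ w ↦ (ψφ) w`. -/
def LFun.eval {X : FinCorr.{u}} (ψ : X ⟶ E) : (LFun ρ).obj X →ₗ[k] W :=
  (balanced ρ X).liftQ (preEval ρ ψ) (balanced_le_ker ρ ψ)

lemma LFun.eval_tmul {X : FinCorr.{u}} (ψ : X ⟶ E) (φ : E ⟶ X) (w : W) :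
    LFun.eval ρ ψ (LFun.tmul ρ φ w) = ρ (φ ≫ ψ : E ⟶ E) w :=
  preEval_single ρ ψ φ w

lemma LFun.eval_map {X Y : FinCorr.{u}} (Q : X ⟶ Y) (ψ : Y ⟶ E) (x : (LFun ρ).obj X) :
    LFun.eval ρ ψ ((LFun ρ).map Q x) = LFun.eval ρ (Q ≫ ψ) x := by
  have h : (preEval ρ ψ).comp (postcomp k E W Q) = preEval ρ (Q ≫ ψ) := by
    refine Finsupp.lhom_ext fun φ w => ?_
    rw [LinearMap.comp_apply, postcomp_single, preEval_single, preEval_single, Category.assoc]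
  obtain ⟨y, rfl⟩ := (balanced ρ X).mkQ_surjective x
  exact LinearMap.congr_fun h y

/-- `J_{E,W}(X)`: the elements `∑ φ_i ⊗ w_i` of `L_{E,W}(X)` with `∑ (ψφ_i) w_i = 0` for all
`ψ ∈ 𝒞(E,X)` (by linearity, for all `ψ ∈ k𝒞(E,X)`). -/
def JSub : Sub (LFun ρ) where
  obj X := ⨅ ψ : X ⟶ E, LinearMap.ker (LFun.eval ρ ψ)
  map_mem {X Y} Q x hx := by
    rw [Submodule.mem_iInf] at hx ⊢
    intro ψ
    exact (LFun.eval_map ρ Q ψ x).trans (hx (Q ≫ ψ))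

end LJ

/-! ### The algebra of permuted orders, fundamental modules and fundamental functors -/

/-- Order relations on `E`: here `(a, b) ∈ R` means `a ≤_R b`. They are ordered by inclusion. -/
def OrderOn (E : Type u) : Type u :=
  {R : SetRel E E // (∀ a, (a, a) ∈ R) ∧ (∀ a b, (a, b) ∈ R → (b, a) ∈ R → a = b) ∧
    ∀ a b c, (a, b) ∈ R → (b, c) ∈ R → (a, c) ∈ R}

instance (E : Type u) : PartialOrder (OrderOn E) :=
  inferInstanceAs (PartialOrder (Subtype _))

instance (E : Type u) [Finite E] : Finite (OrderOn E) :=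
  inferInstanceAs (Finite (Subtype _))

/-- The opposite order. -/
def OrderOn.op {E : Type u} (R : OrderOn E) : OrderOn E :=
  ⟨R.1.inv, fun a => R.2.1 a, fun a b h1 h2 => R.2.2.1 a b h2 h1,
    fun a b c h1 h2 => R.2.2.2 c b a h2 h1⟩

section Fundamental

/-- A relation on `E` is inessential if it factors through a set of smaller cardinality. -/
def Inessential {E : FinCorr.{u}} (Q : End E) : Prop :=
  ∃ (Y : FinCorr.{u}) (A : E ⟶ Y) (B : Y ⟶ E), Nat.card Y < Nat.card E ∧ Q = A ≫ B

/-- Transitive closure of a relation on `E`. -/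
def transClosure {E : FinCorr.{u}} (Q : End E) : End E :=
  toHom {p | Relation.TransGen (fun a b => (a, b) ∈ relOf Q) p.1 p.2}

/-- The relations on the algebra `k𝒞(E,E)` which define the algebra of permuted orders:
inessential relations become zero, and a reflexive relation becomes equal to its transitive
closure. -/
inductive PermOrderRel (k : Type v) [CommRing k] (E : FinCorr.{u}) :
    MonoidAlgebra k (End E) → MonoidAlgebra k (End E) → Prop
  | inessential (Q : End E) : Inessential Q → PermOrderRel k E (MonoidAlgebra.of k (End E) Q) 0
  | closure (Q : End E) : (∀ a : E, (a, a) ∈ relOf Q) →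
      PermOrderRel k E (MonoidAlgebra.of k (End E) Q) (MonoidAlgebra.of k (End E) (transClosure Q))

/-- The algebra of permuted orders `𝒫_E`, a quotient of the algebra of relations `k𝒞(E,E)`
and of the essential algebra. It has as `k`-basis the (classes of the) products `Δ_σ S`, for `σ` a
permutation of `E` and `S` an order on `E`; the product of two orders is the transitive closure of
their union if this is an order, and zero otherwise. -/
def PermOrderAlg (k : Type v) [CommRing k] (E : FinCorr.{u}) : Type max u v :=
  RingQuot (PermOrderRel k E)

instance (k : Type v) [CommRing k] (E : FinCorr.{u}) : Ring (PermOrderAlg k E) :=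
  inferInstanceAs (Ring (RingQuot (PermOrderRel k E)))

instance (k : Type v) [CommRing k] (E : FinCorr.{u}) : Algebra k (PermOrderAlg k E) :=
  inferInstanceAs (Algebra k (RingQuot (PermOrderRel k E)))

/-- The quotient map `k𝒞(E,E) → 𝒫_E`. -/
def PermOrderAlg.quotMap (k : Type v) [CommRing k] (E : FinCorr.{u}) :
    MonoidAlgebra k (End E) →ₐ[k] PermOrderAlg k E :=
  RingQuot.mkAlgHom k (PermOrderRel k E)

/-- The class in `𝒫_E` of a relation on `E`. -/
def permOrderMk (k : Type v) [CommRing k] (E : FinCorr.{u}) : End E →* PermOrderAlg k E :=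
  (PermOrderAlg.quotMap k E : MonoidAlgebra k (End E) →* PermOrderAlg k E).comp
    (MonoidAlgebra.of k (End E))

/-- The relation `Δ_σ = {(σ(x), x) | x ∈ E}`. -/
def permRel {E : FinCorr.{u}} (σ : Equiv.Perm E) : End E :=
  toHom {p | p.1 = σ p.2}

open Classical in
/-- The idempotent `f_R = ∑_{S ⊇ R} μ(R, S) S` of `𝒫_E`, where `S` runs through the orders on `E`
which contain `R` and `μ` is the Möbius function of the poset of orders on `E`. -/
def fIdem (k : Type v) [CommRing k] {E : FinCorr.{u}} (R : OrderOn E) : PermOrderAlg k E :=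
  letI := Fintype.ofFinite (OrderOn E)
  letI : LocallyFiniteOrder (OrderOn E) := Fintype.toLocallyFiniteOrder
  ∑ S : OrderOn E with R ≤ S, IncidenceAlgebra.mu k R S • permOrderMk k E (toHom S.1)

variable (k : Type v) [CommRing k] {E : FinCorr.{u}} (R : OrderOn E)

/-- The fundamental module `𝒫_E f_R`, the left ideal of `𝒫_E` generated by `f_R`. -/
abbrev FundMod : Type max u v := Ideal.span ({fIdem k R} : Set (PermOrderAlg k E))

/-- The action of `k𝒞(E,E)` on the fundamental module, via left multiplication in `𝒫_E`. -/
def fundRep : Representation k (End E) (FundMod k R) :=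
  ((Algebra.lsmul k k (FundMod k R) : PermOrderAlg k E →ₐ[k] Module.End k (FundMod k R)) :
    PermOrderAlg k E →* Module.End k (FundMod k R)).comp (permOrderMk k E)

/-- The fundamental functor `𝕊_{E,R} = L_{E,𝒫_E f_R} / J_{E,𝒫_E f_R}`. -/
def fundFunctor : CorrFunctor.{u} k := (JSub (fundRep k R)).quot

/-- The isomorphism `𝒫_E f_R → 𝕊_{E,R}(E)`, sending `w` to the class of `Δ_E ⊗ w`. -/
def fundEval (w : FundMod k R) : (fundFunctor k R).obj E :=
  (JSub (fundRep k R)).proj.app E (LFun.tmul (fundRep k R) (𝟙 E) w)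

/-- The generator `f_R` of the fundamental module. -/
def fGen : FundMod k R := ⟨fIdem k R, Ideal.subset_span rfl⟩

open Classical in
/-- The property of a morphism `α : 𝕊_{E,R} → 𝕊_{E,R^op}^♮` that the linear form
`α(f_R)` on `𝕊_{E,R^op}(E) ≅ 𝒫_E f_{R^op}` takes the value `1` on `f_{R^op}` and `0` on
`Δ_σ f_{R^op}` for every permutation `σ ≠ 1` of `E`. -/
def IsCanonical (α : fundFunctor k R ⟶ dual (fundFunctor k R.op)) : Prop :=
  ∀ σ : Equiv.Perm E,
    dualApply (α.app E (fundEval k R (fGen k R)))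
      (fundEval k R.op (fundRep k R.op (permRel σ) (fGen k R.op))) = if σ = 1 then 1 else 0

end Fundamental

/-! ### The functor of a finite lattice -/

section Lattice

variable (T : Type u) [Lattice T] [BoundedOrder T]

/-- The action of a correspondence `R ⊆ Y × X` on a map `φ : X → T`:
`(Rφ)(y)` is the join of all `φ(x)` with `(y, x) ∈ R`. -/
def act {T : Type u} [Lattice T] [BoundedOrder T] {X Y : FinCorr.{u}} (R : X ⟶ Y) (φ : X → T) :
    Y → T :=
  fun y => (Set.toFinite {x | (y, x) ∈ relOf R}).toFinset.sup φ

lemma act_le {T : Type u} [Lattice T] [BoundedOrder T] {X Y : FinCorr.{u}} (R : X ⟶ Y)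
    (φ : X → T) (y : Y) (t : T) : act R φ y ≤ t ↔ ∀ x, (y, x) ∈ relOf R → φ x ≤ t := by
  simp [act]

lemma act_id {T : Type u} [Lattice T] [BoundedOrder T] {X : FinCorr.{u}} (φ : X → T) :
    act (𝟙 X) φ = φ := by
  funext y
  apply eq_of_forall_ge_iff
  intro t
  rw [act_le]
  constructor
  · intro h; exact h y rfl
  · intro h x hx
    obtain rfl : y = x := hx
    exact h

lemma act_comp {T : Type u} [Lattice T] [BoundedOrder T] {X Y Z : FinCorr.{u}} (R : X ⟶ Y)
    (S : Y ⟶ Z) (φ : X → T) : act (R ≫ S) φ = act S (act R φ) := by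
  funext z
  apply eq_of_forall_ge_iff
  intro t
  rw [act_le, act_le]
  constructor
  · intro h y hy
    rw [act_le]
    intro x hx
    exact h x ⟨y, hy, hx⟩
  · rintro h x ⟨y, hy, hx⟩
    exact (act_le _ _ _ _).1 (h y hy) x hx

/-- The functor `F_T`: `F_T(X)` is the free `k`-module on the set of maps `X → T`. -/
def FT (k : Type v) [CommRing k] (T : Type u) [Lattice T] [BoundedOrder T] : CorrFunctor.{u} k where
  obj X := ModuleCat.of k ((X → T) →₀ k)
  map R := ModuleCat.ofHom (Finsupp.lmapDomain k k (act R))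
  map_id X := by
    ext φ
    simp [act_id]
  map_comp f g := by
    ext φ
    simp [act_comp]

/-- The basis element of `F_T(X)` given by a map `φ : X → T`. -/
def FT.of (k : Type v) [CommRing k] {T : Type u} [Lattice T] [BoundedOrder T] {X : FinCorr.{u}}
    (φ : X → T) : (FT k T).obj X :=
  (Finsupp.single φ 1 : (X → T) →₀ k)

open Classical in
/-- The bilinear form `k(T^X) × k((T^op)^X) → k`, which sends `(φ, ψ)` to `1` if `φ ≤ ψ`
pointwise in `T`, and to `0` otherwise. -/
def prePairing (k : Type v) [CommRing k] (T : Type u) [Lattice T] (X : FinCorr.{u}) :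
    ((X → T) →₀ k) →ₗ[k] ((X → Tᵒᵈ) →₀ k) →ₗ[k] k :=
  Finsupp.linearCombination k (fun φ : X → T =>
    Finsupp.linearCombination k (fun ψ : X → Tᵒᵈ =>
      if ∀ x, φ x ≤ OrderDual.ofDual (ψ x) then (1 : k) else 0))

/-- The bilinear form `(-,-)_X : F_T(X) × F_{T^op}(X) → k`. -/
def pairing (k : Type v) [CommRing k] (T : Type u) [Lattice T] [BoundedOrder T] (X : FinCorr.{u}) :
    (FT k T).obj X →ₗ[k] (FT k Tᵒᵈ).obj X →ₗ[k] k :=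
  prePairing k T X

lemma pairing_map (k : Type v) [CommRing k] {X Y : FinCorr.{u}} (Q : X ⟶ Y)
    (u : (FT k T).obj Y) (w : (FT k Tᵒᵈ).obj X) :
    pairing k T Y u ((FT k Tᵒᵈ).map Q w) = pairing k T X ((FT k T).map (opCorr Q) u) w := by
  have key : ∀ (φ : Y → T) (ψ : X → Tᵒᵈ), (∀ y, φ y ≤ OrderDual.ofDual (act Q ψ y)) ↔
      ∀ x, act (opCorr Q) φ x ≤ OrderDual.ofDual (ψ x) := by
    intro φ ψ
    simp only [act_le]
    constructor
    · intro h x y hy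
      exact OrderDual.ofDual_le_ofDual.1
        (((act_le Q ψ y (OrderDual.toDual (φ y))).1 (h y)) x hy)
    · intro h y
      exact (act_le Q ψ y (OrderDual.toDual (φ y))).2 fun x hx => h x y hx
  have : (prePairing k T Y).compl₂ (Finsupp.lmapDomain k k (act Q)) =
      (prePairing k T X).comp (Finsupp.lmapDomain k k (act (opCorr Q))) := by
    refine Finsupp.lhom_ext fun φ c => ?_
    refine Finsupp.lhom_ext fun ψ d => ?_
    simp only [LinearMap.compl₂_apply, LinearMap.comp_apply, Finsupp.lmapDomain_apply,
      Finsupp.mapDomain_single, prePairing, Finsupp.linearCombination_single,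
      LinearMap.smul_apply]
    classical
    congr 2
    exact if_congr (key φ ψ) rfl rfl
  exact LinearMap.congr_fun (LinearMap.congr_fun this u) w

variable {T}

/-- The orthogonal in `F_T` of a subfunctor of `F_{T^op}`. -/
def perpLeft (G : Sub (FT k Tᵒᵈ)) : Sub (FT k T) where
  obj X :=
    { carrier := {u | ∀ w ∈ G.obj X, pairing k T X u w = 0}
      add_mem' := fun ha hb w hw => by
        rw [map_add, LinearMap.add_apply, ha w hw, hb w hw, add_zero]
      zero_mem' := fun w _ => by rw [map_zero, LinearMap.zero_apply]
      smul_mem' := fun c a ha w hw => by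
        rw [map_smul, LinearMap.smul_apply, ha w hw, smul_zero] }
  map_mem {X Y} Q a ha w hw := by
    have h := pairing_map T k (opCorr Q) a w
    have e : opCorr (opCorr Q) = Q := rfl
    rw [e] at h
    rw [← h]
    exact ha _ (G.map_mem (opCorr Q) w hw)

/-- The orthogonal in `F_{T^op}` of a subfunctor of `F_T`. -/
def perpRight (H : Sub (FT k T)) : Sub (FT k Tᵒᵈ) where
  obj X :=
    { carrier := {w | ∀ u ∈ H.obj X, pairing k T X u w = 0}
      add_mem' := fun ha hb w hw => by rw [map_add, ha w hw, hb w hw, add_zero]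
      zero_mem' := fun w _ => by rw [map_zero]
      smul_mem' := fun c a ha w hw => by rw [map_smul, ha w hw, smul_zero] }
  map_mem {X Y} Q a ha w hw := by
    rw [pairing_map]
    exact ha _ (H.map_mem (opCorr Q) w hw)

lemma le_perp_perp (G : Sub (FT k Tᵒᵈ)) (X : FinCorr.{u}) :
    G.obj X ≤ (perpRight (perpLeft G)).obj X :=
  fun _ hw _ hu => hu _ hw

variable (T) [Finite T]

/-- The set `E` of (join-)irreducible elements of `T`. -/
def irr : FinCorr.{u} := ⟨{e : T // SupIrred e}⟩

/-- The order `R` on the irreducible elements of `T`, as a full subposet of `T`. -/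
def irrOrder : OrderOn (irr T) :=
  ⟨{p | p.1.1 ≤ p.2.1}, fun _ => le_rfl, fun _ _ h1 h2 => Subtype.ext (le_antisymm h1 h2),
    fun _ _ _ h1 h2 => le_trans h1 h2⟩

/-- The inclusion map `ι : E → T`. -/
def irrIncl : irr T → T := fun e => e.1

variable {T} in
/-- `r(t)` is the join of all elements strictly smaller than `t`. -/
def rJoin (t : T) : T := (Set.toFinite {s : T | s < t}).toFinset.sup id

open Classical in
/-- `η_A : E → T` is given by `η_A(e) = r(e)` if `e ∈ A` and `η_A(e) = e` otherwise. -/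
def eta (A : Finset (irr T)) : irr T → T := fun e => if e ∈ A then rJoin e.1 else e.1

/-- `γ_T = ∑_{A ⊆ E} (-1)^{|A|} η_A^∘ ∈ F_{T^op}(E)`. -/
def gammaT (k : Type v) [CommRing k] : (FT k Tᵒᵈ).obj (irr T) :=
  letI := Fintype.ofFinite (Finset (irr T))
  ∑ A : Finset (irr T), (-1 : k) ^ A.card • FT.of k (fun e => OrderDual.toDual (eta T A e))

/-- The subfunctor `⟨γ_T⟩` of `F_{T^op}` generated by `γ_T`. -/
def gammaSub (k : Type v) [CommRing k] : Sub (FT k Tᵒᵈ) := Sub.gen (gammaT T k)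

/-- The element `γ_T` of `⟨γ_T⟩(E)`. -/
def gammaGen (k : Type v) [CommRing k] : (gammaSub T k).obj (irr T) :=
  ⟨gammaT T k, Sub.mem_gen (gammaT T k)⟩

end Lattice

end CorrFun

end

open CorrFun

noncomputable section

namespace CorrFun

/-! ### Relations on a finite set -/

section Relations

variable {E : FinCorr.{u}}

/-! All functors involved are generated by one element evaluated at `E`: `F_T` by `ι`, the
fundamental functors by `f_R` and `f_{R^op}`, and `⟨γ_T⟩` by `γ_T`. Such a functor is determined by
the kernels of the maps `k𝒞(X,E) → F(X)`, and the proof computes these kernels through one 0/1 form: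
`(ψ, φ) ↦ 1` if `ψφ` is straight, that is `Δ ⊆ ψφ ⊆ R`, and `0` otherwise (`straightPairing`).

For `𝕊_{E,R}`, the kernel is the radical of this form. Indeed `Q f_R` is `Δ_σ f_R` if `Δ_σ⁻¹ Q` is
straight for some (unique) `σ`, and zero otherwise (`permOrderMk_mul_fIdem`). A linear form on `𝒫_E`
reading off the coefficient of `f_R` shows that the `Δ_σ f_R` are independent, and the definition of
`J` turns into membership in the radical (`genMap_fundGen_eq_zero_iff`).

On the lattice side, pairing with `γ_T` is the coefficient of `ι` (`pairing_gammaT`), and `Q ι = ι`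
exactly when `Q` is straight for `R^op` (`act_irrIncl_eq_iff`). So `⟨γ_T⟩^⊥` is the radical for
`R^op`, which gives `Θ_T` together with its kernel. Passing to opposite correspondences, the
relations satisfied by `γ_T` form the radical for `R`, whence `𝕊_{E,R} ≅ ⟨γ_T⟩`.

The form between `F_T` and `F_{T^op}` is perfect, by Möbius inversion on the poset of maps `X → T`,
so the orthogonal of `ker Θ_T` is the dual of its image. Finally `α(f_R)(Δ_σ f_{R^op}) = (Δ_σ ι,
γ_T)` is the coefficient of `ι` in `Δ_σ ι`, and these values determine `α`. -/

/-- A relation on `E` is straight with respect to an order `R` if it is reflexive and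
contained in `R`. -/
def Straight (R : OrderOn E) (Q : End E) : Prop :=
  (∀ a : E, (a, a) ∈ relOf Q) ∧ ∀ a b : E, (a, b) ∈ relOf Q → (a, b) ∈ R.1

lemma hom_ext_rel {X Y : FinCorr.{u}} {Q Q' : X ⟶ Y}
    (h : ∀ y x, (y, x) ∈ relOf Q ↔ (y, x) ∈ relOf Q') : Q = Q' := by
  apply Corr.ext
  ext ⟨y, x⟩
  exact h y x

lemma mem_relOf_comp {X Y Z : FinCorr.{u}} (P : X ⟶ Y) (Q : Y ⟶ Z) (z : Z) (x : X) :
    (z, x) ∈ relOf (P ≫ Q) ↔ ∃ y, (z, y) ∈ relOf Q ∧ (y, x) ∈ relOf P :=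
  Iff.rfl

lemma mem_relOf_mul (P Q : End E) (a c : E) :
    (a, c) ∈ relOf (P * Q) ↔ ∃ b, (a, b) ∈ relOf P ∧ (b, c) ∈ relOf Q :=
  Iff.rfl

lemma mem_relOf_permRel (σ : Equiv.Perm E) (a b : E) :
    (a, b) ∈ relOf (permRel σ) ↔ a = σ b :=
  Iff.rfl

lemma mem_relOf_permRel_inv_mul (σ : Equiv.Perm E) (Q : End E) (a b : E) :
    (a, b) ∈ relOf (permRel σ⁻¹ * Q) ↔ (σ a, b) ∈ relOf Q := by
  rw [mem_relOf_mul]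
  constructor
  · rintro ⟨c, hc, h⟩
    rw [mem_relOf_permRel] at hc
    subst hc
    simpa using h
  · intro h
    exact ⟨σ a, by simp [mem_relOf_permRel], h⟩

lemma permRel_one : permRel (1 : Equiv.Perm E) = 1 :=
  rfl

lemma permRel_mul (σ τ : Equiv.Perm E) : permRel (σ * τ) = permRel σ * permRel τ := by
  apply hom_ext_rel
  intro a b
  rw [mem_relOf_permRel, mem_relOf_mul]
  constructor
  · intro h
    exact ⟨τ b, h, rfl⟩
  · rintro ⟨c, h1, h2⟩
    rw [mem_relOf_permRel] at h1 h2
    rw [h1, h2]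
    rfl

lemma mem_transClosure (Q : End E) (a b : E) :
    (a, b) ∈ relOf (transClosure Q) ↔
      Relation.TransGen (fun x y => (x, y) ∈ relOf Q) a b :=
  Iff.rfl

lemma transClosure_subset (Q : End E) (R : OrderOn E)
    (h : ∀ a b, (a, b) ∈ relOf Q → (a, b) ∈ R.1) (a b : E)
    (hab : (a, b) ∈ relOf (transClosure Q)) : (a, b) ∈ R.1 := by
  rw [mem_transClosure] at hab
  induction hab with
  | single h1 => exact h _ _ h1
  | tail _ h2 ih => exact R.2.2.2 _ _ _ ih (h _ _ h2)

/-- A permutation whose graph is contained in an order is the identity. -/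
lemma perm_eq_one_of_mem_order (R : OrderOn E) (σ : Equiv.Perm E)
    (h : ∀ a, (σ a, a) ∈ R.1) : σ = 1 := by
  have hpow : ∀ (n : ℕ) (a : E), ((σ ^ n) a, a) ∈ R.1 := by
    intro n
    induction n with
    | zero => intro a; exact R.2.1 a
    | succ n ih =>
      intro a
      rw [pow_succ', Equiv.Perm.mul_apply]
      exact R.2.2.2 _ _ _ (h _) (ih a)
  ext a
  refine R.2.2.1 _ _ (h a) ?_
  -- If `n` is the order of `σ`, then `σ^(n-1)` sends `σ a` to `a`, so `(a, σ a)` lies in `R` and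
  -- antisymmetry applies.
  have hpos : 0 < orderOf σ := orderOf_pos σ
  have h1 := hpow (orderOf σ - 1) (σ a)
  have h2 : (σ ^ (orderOf σ - 1)) (σ a) = a := by
    rw [← Equiv.Perm.mul_apply, ← pow_succ, Nat.sub_add_cancel hpos, pow_orderOf_eq_one]
    rfl
  rwa [h2] at h1

/-- Since `(σ a, a) ∈ Q`, straightness of `Δ_τ⁻¹ Q` puts the graph of `τ⁻¹σ` inside `R`. -/
lemma straight_unique (R : OrderOn E) (Q : End E) {σ τ : Equiv.Perm E}
    (hσ : Straight R (permRel σ⁻¹ * Q)) (hτ : Straight R (permRel τ⁻¹ * Q)) : σ = τ := by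
  have h : τ⁻¹ * σ = 1 := by
    apply perm_eq_one_of_mem_order R
    intro a
    refine hτ.2 _ _ ?_
    rw [mem_relOf_permRel_inv_mul]
    have h1 := hσ.1 a
    rw [mem_relOf_permRel_inv_mul] at h1
    simpa using h1
  exact (inv_mul_eq_one.1 h).symm

/-! ### Inessential relations and straightness -/

/-- A relation on `E` which contains no permutation is inessential (Hall's theorem). -/
lemma inessential_of_no_perm (Q : End E)
    (h : ∀ σ : Equiv.Perm E, ¬ ∀ a, (σ a, a) ∈ relOf Q) : Inessential Q := by
  classical
  let _ := Fintype.ofFinite E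
  by_contra hQ
  have hall : ∀ A : Finset E, A.card ≤
      (Finset.univ.filter fun b => ∃ a ∈ A, (b, a) ∈ relOf Q).card := by
    intro A
    by_contra! hA
    apply hQ
    set N := Finset.univ.filter fun b => ∃ a ∈ A, (b, a) ∈ relOf Q with hN
    -- Hall's condition fails at `A`, so the complement of `A` together with its set of neighbours
    -- `N` has fewer than `|E|` elements. `Q` factors through this union: points outside `A` pass
    -- through themselves, points of `A` through their images.
    refine ⟨⟨{x : E // x ∉ A} ⊕ {x : E // x ∈ N}⟩,
      toHom {p | Sum.elim (fun y => y.1 = p.2) (fun y => p.2 ∈ A ∧ (y.1, p.2) ∈ relOf Q) p.1},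
      toHom {p | Sum.elim (fun y => (p.1, y.1) ∈ relOf Q) (fun y => p.1 = y.1) p.2}, ?_, ?_⟩
    · change Nat.card ({x : E // x ∉ A} ⊕ {x : E // x ∈ N}) < _
      rw [Nat.card_sum]
      simp only [Nat.card_eq_fintype_card, Fintype.card_subtype_compl, Fintype.card_coe]
      have := Finset.card_le_univ A
      omega
    · apply hom_ext_rel
      intro z x
      rw [mem_relOf_comp]
      constructor
      · intro hzx
        by_cases hx : x ∈ A
        · exact ⟨Sum.inr ⟨z, by rw [hN]; simpa using ⟨x, hx, hzx⟩⟩, rfl, hx, hzx⟩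
        · exact ⟨Sum.inl ⟨x, hx⟩, hzx, rfl⟩
      · rintro ⟨y | y, h1, h2⟩
        · obtain rfl : y.1 = x := h2
          exact h1
        · obtain rfl : z = y.1 := h1
          exact h2.2
  obtain ⟨f, hf, hfr⟩ := (Fintype.all_card_le_filter_rel_iff_exists_injective
    (fun a b : E => (b, a) ∈ relOf Q)).1 hall
  exact h (Equiv.ofBijective f (Finite.injective_iff_bijective.1 hf)) hfr

/-- A preorder on `E` which is not an order is inessential. -/
lemma inessential_of_preorder (Q : End E) (hrefl : ∀ a : E, (a, a) ∈ relOf Q)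
    (htrans : ∀ a b c : E, (a, b) ∈ relOf Q → (b, c) ∈ relOf Q → (a, c) ∈ relOf Q)
    {a b : E} (hab : (a, b) ∈ relOf Q) (hba : (b, a) ∈ relOf Q) (hne : a ≠ b) :
    Inessential Q := by
  classical
  -- The point `a` can be dropped because the equivalent point `b` replaces it as an intermediate
  -- point.
  refine ⟨⟨{x : E // x ≠ a}⟩, toHom {p | (p.1.1, p.2) ∈ relOf Q},
    toHom {p | (p.1, p.2.1) ∈ relOf Q}, ?_, ?_⟩
  · change Nat.card {x : E // x ≠ a} < _
    exact Finite.card_subtype_lt (x := a) (by simp)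
  · apply hom_ext_rel
    intro z x
    rw [mem_relOf_comp]
    constructor
    · intro hzx
      by_cases hz : z = a
      · subst hz
        exact ⟨⟨b, hne.symm⟩, hab, htrans _ _ _ hba hzx⟩
      · exact ⟨⟨z, hz⟩, hrefl z, hzx⟩
    · rintro ⟨y, h1, h2⟩
      exact htrans _ _ _ h1 h2

lemma Inessential.mul_mul {Q : End E} (h : Inessential Q) (A B : End E) :
    Inessential (A * Q * B) := by
  obtain ⟨Y, C, D, hY, rfl⟩ := h
  exact ⟨Y, B ≫ C, D ≫ A, hY, by simp [End.mul_def]⟩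

/-- Each diagonal pair `(a, a)` passes through some point `y a` of the small set. If `y a = y b`,
then `(a, b)` and `(b, a)` are both in `R`; so `y` would be an injection of `E` into a smaller set.
-/
lemma not_straight_of_inessential (R : OrderOn E) {Q : End E} (hQ : Inessential Q) :
    ¬ Straight R Q := by
  rintro ⟨h1, h2⟩
  obtain ⟨Y, A, B, hY, rfl⟩ := hQ
  choose y hy using h1
  have hinj : Function.Injective y := by
    intro a b hab
    refine R.2.2.1 _ _ (h2 _ _ ⟨y a, (hy a).1, ?_⟩) (h2 _ _ ⟨y b, (hy b).1, ?_⟩)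
    · rw [hab]; exact (hy b).2
    · rw [← hab]; exact (hy a).2
  exact absurd (Nat.card_le_card_of_injective y hinj) (not_le.2 hY)

/-- If `A Q B` is straight with `Q` reflexive, then `A` and `B` contain mutually inverse
permutations. -/
lemma exists_perm_of_straight (R : OrderOn E) (A Q B : End E)
    (hQ : ∀ a : E, (a, a) ∈ relOf Q) (h : Straight R (A * Q * B)) :
    ∃ y : Equiv.Perm E, (∀ a, (a, y a) ∈ relOf A) ∧ ∀ a, (y a, a) ∈ relOf B := by
  have hmem : ∀ {a b c d : E}, (a, b) ∈ relOf A → (b, c) ∈ relOf Q → (c, d) ∈ relOf B →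
      (a, d) ∈ R.1 := fun h1 h2 h3 => h.2 _ _ ⟨_, ⟨_, h1, h2⟩, h3⟩
  have hex : ∀ a : E, ∃ y z : E, (a, y) ∈ relOf A ∧ (y, z) ∈ relOf Q ∧ (z, a) ∈ relOf B := by
    intro a
    obtain ⟨z, ⟨y, h1, h2⟩, h3⟩ := h.1 a
    exact ⟨y, z, h1, h2, h3⟩
  choose y z hA hyz hB using hex
  have hyinj : Function.Injective y := by
    intro a b hab
    refine R.2.2.1 _ _ (hmem (hA a) ?_ (hB b)) (hmem (hA b) ?_ (hB a))
    · rw [hab]; exact hyz b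
    · rw [← hab]; exact hyz a
  have hzinj : Function.Injective z := by
    intro a b hab
    refine R.2.2.1 _ _ (hmem (hA a) (hyz a) ?_) (hmem (hA b) (hyz b) ?_)
    · rw [hab]; exact hB b
    · rw [← hab]; exact hB a
  let y' : Equiv.Perm E := Equiv.ofBijective y (Finite.injective_iff_bijective.1 hyinj)
  let z' : Equiv.Perm E := Equiv.ofBijective z (Finite.injective_iff_bijective.1 hzinj)
  have hρ : ∀ a, y ((y'⁻¹ * z') a) = z a := fun a => y'.apply_symm_apply (z a)
  -- The paths from `a` through `y` and `z` back to `a` show that the graph of `y'⁻¹ z'` lies in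
  -- `R`; hence `y = z`.
  have h1 : y'⁻¹ * z' = 1 := by
    apply perm_eq_one_of_mem_order R
    intro a
    have h2 := hA ((y'⁻¹ * z') a)
    rw [hρ] at h2
    exact hmem h2 (hQ _) (hB a)
  refine ⟨y', hA, fun a => ?_⟩
  have h2 := hρ a
  rw [h1] at h2
  change (y a, a) ∈ relOf B
  change y a = z a at h2
  rw [h2]
  exact hB a

lemma subset_transClosure (Q : End E) {a b : E} (h : (a, b) ∈ relOf Q) :
    (a, b) ∈ relOf (transClosure Q) :=
  Relation.TransGen.single h

/-- The permutation `y` supplied by `exists_perm_of_straight` transports `Q` into the order `R`, and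
a relation contained in a transitive one keeps this property after transitive closure. This is why
the straightness indicator is compatible with the relations `Q - Q̄`. -/
lemma straight_transClosure (R : OrderOn E) (A Q B : End E) (hQ : ∀ a : E, (a, a) ∈ relOf Q) :
    Straight R (A * Q * B) ↔ Straight R (A * transClosure Q * B) := by
  constructor
  · intro h
    obtain ⟨y, hA, hB⟩ := exists_perm_of_straight R A Q B hQ h
    have hmem : ∀ {a b c d : E}, (a, b) ∈ relOf A → (b, c) ∈ relOf Q → (c, d) ∈ relOf B →
        (a, d) ∈ R.1 := fun h1 h2 h3 => h.2 _ _ ⟨_, ⟨_, h1, h2⟩, h3⟩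
    have hclos : ∀ p q : E, Relation.TransGen (fun x y => (x, y) ∈ relOf Q) p q →
        (y.symm p, y.symm q) ∈ R.1 := by
      intro p q hpq
      have hstep : ∀ p q : E, (p, q) ∈ relOf Q → (y.symm p, y.symm q) ∈ R.1 := by
        intro p q h1
        have h2 := hA (y.symm p)
        have h3 := hB (y.symm q)
        rw [Equiv.apply_symm_apply] at h2 h3
        exact hmem h2 h1 h3
      induction hpq with
      | single h1 => exact hstep _ _ h1
      | tail _ h2 ih => exact R.2.2.2 _ _ _ ih (hstep _ _ h2)
    refine ⟨fun a => ⟨y a, ⟨y a, hA a, subset_transClosure Q (hQ _)⟩, hB a⟩, ?_⟩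
    rintro a d ⟨c, ⟨b, h1, h2⟩, h3⟩
    have h4 : (a, y.symm b) ∈ R.1 := by
      have h5 := hB (y.symm b)
      rw [Equiv.apply_symm_apply] at h5
      exact hmem h1 (hQ b) h5
    have h6 : (y.symm c, d) ∈ R.1 := by
      have h5 := hA (y.symm c)
      rw [Equiv.apply_symm_apply] at h5
      exact hmem h5 (hQ c) h3
    exact R.2.2.2 _ _ _ h4 (R.2.2.2 _ _ _ (hclos _ _ h2) h6)
  · intro h
    obtain ⟨y, hA, hB⟩ := exists_perm_of_straight R A (transClosure Q) B
      (fun a => subset_transClosure Q (hQ a)) h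
    refine ⟨fun a => ⟨y a, ⟨y a, hA a, hQ _⟩, hB a⟩, ?_⟩
    rintro a d ⟨c, ⟨b, h1, h2⟩, h3⟩
    exact h.2 _ _ ⟨c, ⟨b, h1, subset_transClosure Q h2⟩, h3⟩

end Relations

/-! ### The action of relations on the fundamental module -/

section Algebra

variable {k : Type v} [CommRing k] {E : FinCorr.{u}}

/-- An order on `E`, as an endomorphism of `E`. -/
def orderRel (S : OrderOn E) : End E :=
  toHom S.1

lemma permOrderMk_of_inessential {Q : End E} (h : Inessential Q) : permOrderMk k E Q = 0 := by
  have := RingQuot.mkAlgHom_rel k (PermOrderRel.inessential (k := k) Q h)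
  rwa [map_zero] at this

lemma permOrderMk_transClosure (Q : End E) (h : ∀ a : E, (a, a) ∈ relOf Q) :
    permOrderMk k E (transClosure Q) = permOrderMk k E Q :=
  (RingQuot.mkAlgHom_rel k (PermOrderRel.closure (k := k) Q h)).symm

-- Möbius inversion of the definition of the `f_S`.
open Classical in
lemma permOrderMk_order (S : OrderOn E) :
    letI := Fintype.ofFinite (OrderOn E)
    permOrderMk k E (orderRel S) = ∑ S' : OrderOn E with S ≤ S', fIdem k S' := by
  let _ := Fintype.ofFinite (OrderOn E)
  let _ : LocallyFiniteOrder (OrderOn E) := Fintype.toLocallyFiniteOrder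
  have h1 : ∀ S' : OrderOn E, fIdem k S' =
      ∑ U : OrderOn E, if S' ≤ U then
        IncidenceAlgebra.mu k S' U • permOrderMk k E (orderRel U) else 0 := by
    intro S'
    rw [← Finset.sum_filter]
    rfl
  have h2 : ∀ U : OrderOn E, (∑ S' : OrderOn E, if S ≤ S' ∧ S' ≤ U then
      IncidenceAlgebra.mu k S' U else 0) = if S = U then 1 else 0 := by
    intro U
    rw [← IncidenceAlgebra.sum_Icc_mu_left S U, ← Finset.sum_filter]
    refine Finset.sum_congr ?_ fun _ _ => rfl
    ext V
    simp
  calc permOrderMk k E (orderRel S)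
      = ∑ U : OrderOn E, (if S = U then (1 : k) else 0) • permOrderMk k E (orderRel U) := by simp
    _ = ∑ U : OrderOn E, ∑ S' : OrderOn E, if S ≤ S' then (if S' ≤ U then
          IncidenceAlgebra.mu k S' U • permOrderMk k E (orderRel U) else 0) else 0 := by
        refine Finset.sum_congr rfl fun U _ => ?_
        rw [← h2, Finset.sum_smul]
        refine Finset.sum_congr rfl fun S' _ => ?_
        by_cases h3 : S ≤ S' <;> by_cases h4 : S' ≤ U <;> simp [h3, h4]
    _ = _ := by
        rw [Finset.sum_comm, Finset.sum_filter]
        refine Finset.sum_congr rfl fun S' _ => ?_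
        rw [h1]
        split_ifs <;> simp

open Classical in
/-- A reflexive relation is, in `𝒫_E`, the sum of all `f_S` for the orders `S` containing it. -/
lemma permOrderMk_eq_sum (Q : End E) (hQ : ∀ a : E, (a, a) ∈ relOf Q) :
    letI := Fintype.ofFinite (OrderOn E)
    permOrderMk k E Q =
      ∑ S : OrderOn E with (∀ a b : E, (a, b) ∈ relOf Q → (a, b) ∈ S.1), fIdem k S := by
  let _ := Fintype.ofFinite (OrderOn E)
  have hrefl : ∀ a : E, (a, a) ∈ relOf (transClosure Q) := fun a => subset_transClosure Q (hQ a)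
  have htrans : ∀ a b c : E, (a, b) ∈ relOf (transClosure Q) →
      (b, c) ∈ relOf (transClosure Q) → (a, c) ∈ relOf (transClosure Q) :=
    fun a b c h1 h2 => Relation.TransGen.trans h1 h2
  by_cases h : ∀ a b : E, (a, b) ∈ relOf (transClosure Q) → (b, a) ∈ relOf (transClosure Q) → a = b
  · have h1 := permOrderMk_order (k := k) (E := E) ⟨relOf (transClosure Q), hrefl, h, htrans⟩
    change permOrderMk k E (transClosure Q) = _ at h1
    rw [← permOrderMk_transClosure Q hQ, h1]
    refine Finset.sum_congr ?_ fun _ _ => rfl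
    ext S
    simp only [Finset.mem_filter, Finset.mem_univ, true_and]
    constructor
    · intro hS a b hab
      exact hS (subset_transClosure Q hab)
    · rintro hS ⟨a, b⟩ hab
      exact transClosure_subset Q S hS a b hab
  -- If the closure is not antisymmetric, its class is zero, and the sum is empty since no order
  -- contains `Q`.
  · push Not at h
    obtain ⟨a, b, hab, hba, hne⟩ := h
    rw [← permOrderMk_transClosure Q hQ,
      permOrderMk_of_inessential (inessential_of_preorder _ hrefl htrans hab hba hne),
      Finset.sum_eq_zero]
    intro S hS
    rw [Finset.mem_filter] at hS
    exact absurd (S.2.2.1 _ _ (transClosure_subset Q S hS.2 _ _ hab)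
      (transClosure_subset Q S hS.2 _ _ hba)) hne

-- Induction from larger orders to smaller ones. Multiplying `R = ∑_{S ⊇ R} f_S` by `Q` gives the
-- class of the reflexive relation `QR`, which is the sum of the `f_S` with `S` containing both `R`
-- and `Q`. Cancelling the terms `S ≠ R`, known by induction, leaves the term of `R`.
open Classical in
lemma permOrderMk_mul_fIdem_of_refl (Q : End E) (hQ : ∀ a : E, (a, a) ∈ relOf Q) (R : OrderOn E) :
    permOrderMk k E Q * fIdem k R = if Straight R Q then fIdem k R else 0 := by
  let _ := Fintype.ofFinite (OrderOn E)
  induction R using (wellFounded_gt (α := OrderOn E)).induction with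
  | _ R ih =>
  have hQS : ∀ S : OrderOn E, Straight S Q ↔ ∀ a b : E, (a, b) ∈ relOf Q → (a, b) ∈ S.1 :=
    fun S => ⟨fun h => h.2, fun h => ⟨hQ, h⟩⟩
  have h1 : permOrderMk k E Q * permOrderMk k E (orderRel R) =
      ∑ S : OrderOn E with R ≤ S, if Straight S Q then fIdem k S else 0 := by
    rw [← map_mul, permOrderMk_eq_sum (k := k) (Q * orderRel R) fun a => ⟨a, hQ a, R.2.1 a⟩,
      ← Finset.sum_filter, Finset.filter_filter]
    refine Finset.sum_congr ?_ fun _ _ => rfl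
    ext S
    simp only [Finset.mem_filter, Finset.mem_univ, true_and, hQS]
    constructor
    · intro h
      exact ⟨fun ⟨a, b⟩ hab => h a b ⟨a, hQ a, hab⟩, fun a b hab => h a b ⟨b, hab, R.2.1 b⟩⟩
    · rintro ⟨h2, h3⟩ a b ⟨c, h4, h5⟩
      exact S.2.2.2 _ _ _ (h3 _ _ h4) (h2 h5)
  rw [permOrderMk_order, Finset.mul_sum] at h1
  have hR : R ∈ (Finset.univ.filter fun S : OrderOn E => R ≤ S) := by simp
  rw [← Finset.add_sum_erase _ _ hR, ← Finset.add_sum_erase _ _ hR] at h1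
  rw [Finset.sum_congr rfl (g := fun S => if Straight S Q then fIdem k S else 0)] at h1
  · exact add_right_cancel h1
  · intro S hS
    simp only [Finset.mem_erase, Finset.mem_filter, Finset.mem_univ, true_and] at hS
    exact ih S (lt_of_le_of_ne hS.2 (Ne.symm hS.1))

lemma permRel_mul_inv_mul (σ : Equiv.Perm E) (Q : End E) :
    permRel σ * (permRel σ⁻¹ * Q) = Q := by
  rw [← mul_assoc, ← permRel_mul, mul_inv_cancel, permRel_one, one_mul]

-- By `straight_unique` the sum has at most one nonzero term. If `Q` contains a permutation,
-- translating by its inverse makes `Q` reflexive; if it contains none, `Q` is inessential and both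
-- sides vanish.
open Classical in
lemma permOrderMk_mul_fIdem (Q : End E) (R : OrderOn E) :
    letI := Fintype.ofFinite E
    permOrderMk k E Q * fIdem k R = ∑ σ : Equiv.Perm E,
      if Straight R (permRel σ⁻¹ * Q) then permOrderMk k E (permRel σ) * fIdem k R else 0 := by
  let _ := Fintype.ofFinite E
  by_cases h : ∃ σ : Equiv.Perm E, ∀ a, (σ a, a) ∈ relOf Q
  · obtain ⟨σ, hσ⟩ := h
    have hrefl : ∀ a : E, (a, a) ∈ relOf (permRel σ⁻¹ * Q) := fun a => by
      rw [mem_relOf_permRel_inv_mul]; exact hσ a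
    by_cases hex : ∃ τ : Equiv.Perm E, Straight R (permRel τ⁻¹ * Q)
    · obtain ⟨τ, hτ⟩ := hex
      rw [Finset.sum_eq_single τ]
      · rw [if_pos hτ]
        conv_lhs => rw [← permRel_mul_inv_mul τ Q, map_mul, mul_assoc,
          permOrderMk_mul_fIdem_of_refl _ hτ.1, if_pos hτ]
      · intro υ _ hυ
        exact if_neg fun h => hυ (straight_unique R Q h hτ)
      · simp
    · push Not at hex
      rw [Finset.sum_eq_zero fun τ _ => if_neg (hex τ)]
      rw [← permRel_mul_inv_mul σ Q, map_mul, mul_assoc,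
        permOrderMk_mul_fIdem_of_refl _ hrefl, if_neg (hex σ), mul_zero]
  · push Not at h
    rw [permOrderMk_of_inessential (inessential_of_no_perm Q fun σ hσ => ?_), zero_mul,
      Finset.sum_eq_zero]
    · intro σ _
      refine if_neg fun hσ => ?_
      obtain ⟨a, ha⟩ := h σ
      have := hσ.1 a
      rw [mem_relOf_permRel_inv_mul] at this
      exact ha this
    · obtain ⟨a, ha⟩ := h σ
      exact ha (hσ a)

/-! ### Linear forms on `𝒫_E` and the coefficient of `f_R` -/

/-- The functions on relations which are compatible with the defining relations of `𝒫_E`. -/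
def compatibleFun (k : Type v) [CommRing k] (E : FinCorr.{u}) : Submodule k (End E → k) where
  carrier := {f | (∀ Q A B : End E, Inessential Q → f (A * Q * B) = 0) ∧
    ∀ Q A B : End E, (∀ a : E, (a, a) ∈ relOf Q) → f (A * Q * B) = f (A * transClosure Q * B)}
  add_mem' hf hg := ⟨fun Q A B h => by rw [Pi.add_apply, hf.1 Q A B h, hg.1 Q A B h, add_zero],
    fun Q A B h => by rw [Pi.add_apply, Pi.add_apply, hf.2 Q A B h, hg.2 Q A B h]⟩
  zero_mem' := ⟨fun _ _ _ _ => rfl, fun _ _ _ _ => rfl⟩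
  smul_mem' c f hf := ⟨fun Q A B h => by rw [Pi.smul_apply, hf.1 Q A B h, smul_zero],
    fun Q A B h => by rw [Pi.smul_apply, Pi.smul_apply, hf.2 Q A B h]⟩

/-- Right translation of the functions on relations. -/
def translateRep (k : Type v) [CommRing k] (E : FinCorr.{u}) :
    Representation k (End E) (compatibleFun k E) where
  toFun Q := (LinearMap.funLeft k k fun A : End E => A * Q).restrict fun f hf =>
    ⟨fun P A B h => by
      simpa only [LinearMap.funLeft_apply, mul_assoc] using hf.1 P A (B * Q) h,
    fun P A B h => by
      simpa only [LinearMap.funLeft_apply, mul_assoc] using hf.2 P A (B * Q) h⟩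
  map_one' := by
    ext f A
    exact congrArg f.1 (mul_one A)
  map_mul' P Q := by
    ext f A
    exact congrArg f.1 (mul_assoc A P Q).symm

/-- Right translation of the functions on relations, as an action of `𝒫_E`. -/
def translateHom (k : Type v) [CommRing k] (E : FinCorr.{u}) :
    PermOrderAlg k E →ₐ[k] Module.End k (compatibleFun k E) :=
  RingQuot.liftAlgHom k ⟨MonoidAlgebra.lift k _ _ (translateRep k E), fun x y h => by
    cases h with
    | inessential Q hQ =>
      rw [MonoidAlgebra.lift_of, map_zero]
      ext f A
      have := f.2.1 Q A 1 hQ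
      rwa [mul_one] at this
    | closure Q hQ =>
      rw [MonoidAlgebra.lift_of, MonoidAlgebra.lift_of]
      ext f A
      have := f.2.2 Q A 1 hQ
      rwa [mul_one, mul_one] at this⟩

lemma translateHom_permOrderMk (Q : End E) :
    translateHom k E (permOrderMk k E Q) = translateRep k E Q := by
  change RingQuot.liftAlgHom k _ (RingQuot.mkAlgHom k _ _) = _
  rw [RingQuot.liftAlgHom_mkAlgHom_apply]
  exact MonoidAlgebra.lift_of _ _

/-- The linear form on `𝒫_E` defined by a compatible function. -/
def compatibleForm (f : compatibleFun k E) : PermOrderAlg k E →ₗ[k] k :=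
  (LinearMap.proj (1 : End E)) ∘ₗ (compatibleFun k E).subtype ∘ₗ LinearMap.applyₗ f ∘ₗ
    (translateHom k E).toLinearMap

/-- A function on relations need not be multiplicative, so it does not itself define an algebra map
on `𝒫_E`. Instead `𝒫_E` acts by right translation on compatible functions, and evaluating the
translate at the identity relation recovers `f`. The two-sided factors in `compatibleFun` make that
space stable under translation. -/
lemma compatibleForm_permOrderMk (f : compatibleFun k E) (Q : End E) :
    compatibleForm f (permOrderMk k E Q) = f.1 Q := by
  change (translateHom k E (permOrderMk k E Q) f).1 1 = _
  rw [translateHom_permOrderMk]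
  exact congrArg f.1 (one_mul Q)

open Classical in
/-- The linear form on `𝒫_E` which sends a straight relation to `1` and any other to `0`. -/
def straightForm (k : Type v) [CommRing k] (R : OrderOn E) : PermOrderAlg k E →ₗ[k] k :=
  compatibleForm ⟨fun Q => if Straight R Q then 1 else 0,
    fun _ A B h => if_neg (not_straight_of_inessential R (h.mul_mul A B)),
    fun Q A B h => if_congr (straight_transClosure R A Q B h) rfl rfl⟩

open Classical in
lemma straightForm_permOrderMk (R : OrderOn E) (Q : End E) :
    straightForm k R (permOrderMk k E Q) = if Straight R Q then 1 else 0 :=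
  compatibleForm_permOrderMk _ _

-- In the expansion of `Δ_σ f_R`, a relation `Δ_σ S` with `S ⊇ R` can be straight only if `σ = 1`,
-- because `S` is reflexive, and then only if `S = R`. This separates the elements `Δ_σ f_R`.
open Classical in
lemma straightForm_permRel_mul_fIdem (R : OrderOn E) (σ : Equiv.Perm E) :
    straightForm k R (permOrderMk k E (permRel σ) * fIdem k R) = if σ = 1 then 1 else 0 := by
  let _ := Fintype.ofFinite (OrderOn E)
  let _ : LocallyFiniteOrder (OrderOn E) := Fintype.toLocallyFiniteOrder
  have h1 : fIdem k R = ∑ S : OrderOn E with R ≤ S,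
      IncidenceAlgebra.mu k R S • permOrderMk k E (orderRel S) := rfl
  have h2 : ∀ S : OrderOn E, R ≤ S →
      (Straight R (permRel σ * orderRel S) ↔ σ = 1 ∧ R = S) := by
    intro S hS
    constructor
    · rintro ⟨-, h⟩
      have hσ : σ = 1 := perm_eq_one_of_mem_order R σ fun a =>
        h _ _ ⟨a, rfl, S.2.1 a⟩
      subst hσ
      refine ⟨rfl, le_antisymm hS ?_⟩
      rintro ⟨a, b⟩ hab
      exact h _ _ ⟨a, rfl, hab⟩
    · rintro ⟨rfl, rfl⟩
      rw [permRel_one, one_mul]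
      exact ⟨fun a => R.2.1 a, fun a b h => h⟩
  rw [h1, Finset.mul_sum, map_sum, Finset.sum_eq_single R]
  · rw [mul_smul_comm, map_smul, ← map_mul, straightForm_permOrderMk,
      if_congr (h2 R le_rfl) rfl rfl, IncidenceAlgebra.mu_self, one_smul]
    simp
  · intro S hS hne
    rw [mul_smul_comm, map_smul, ← map_mul, straightForm_permOrderMk,
      if_congr (h2 S (Finset.mem_filter.1 hS).2) rfl rfl, if_neg fun h => hne h.2.symm, smul_zero]
  · simp

open Classical in
/-- The coefficient of `f_R` in `Q f_R`. -/
lemma straightForm_mul_fIdem (R : OrderOn E) (Q : End E) :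
    straightForm k R (permOrderMk k E Q * fIdem k R) = if Straight R Q then 1 else 0 := by
  rw [permOrderMk_mul_fIdem, map_sum, Finset.sum_eq_single 1]
  · rw [inv_one, permRel_one, one_mul]
    split_ifs
    · rw [← permRel_one, straightForm_permRel_mul_fIdem, if_pos rfl]
    · exact map_zero _
  · intro σ _ hσ
    split_ifs
    · rw [straightForm_permRel_mul_fIdem, if_neg hσ]
    · exact map_zero _
  · simp

end Algebra

/-! ### Correspondence functors generated by one element -/

section Generated

variable {k : Type v} [CommRing k] {E : FinCorr.{u}} {F F' : CorrFunctor.{u} k}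

/-- The linear map `k𝒞(X,E) → F(X)`, `φ ↦ F(φ)(g)`. -/
def genMap (g : F.obj E) (X : FinCorr.{u}) : ((E ⟶ X) →₀ k) →ₗ[k] F.obj X :=
  Finsupp.linearCombination k fun φ : E ⟶ X => F.map φ g

lemma genMap_single (g : F.obj E) {X : FinCorr.{u}} (φ : E ⟶ X) :
    genMap g X (Finsupp.single φ 1) = F.map φ g := by
  simp [genMap]

lemma app_genMap (θ : F ⟶ F') (g : F.obj E) (X : FinCorr.{u}) (u : (E ⟶ X) →₀ k) :
    θ.app X (genMap g X u) = genMap (θ.app E g) X u := by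
  have h : (θ.app X).hom ∘ₗ genMap g X = genMap (θ.app E g) X := by
    refine Finsupp.lhom_ext' fun φ => LinearMap.ext_ring ?_
    change θ.app X (genMap g X (Finsupp.single φ 1)) = genMap _ X (Finsupp.single φ 1)
    rw [genMap_single, genMap_single]
    exact NatTrans.naturality_apply θ φ g
  exact LinearMap.congr_fun h u

lemma map_genMap (g : F.obj E) {X Y : FinCorr.{u}} (Q : X ⟶ Y) (u : (E ⟶ X) →₀ k) :
    F.map Q (genMap g X u) = genMap g Y (Finsupp.lmapDomain k k (fun φ : E ⟶ X => φ ≫ Q) u) := by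
  have h : (F.map Q).hom ∘ₗ genMap g X =
      genMap g Y ∘ₗ Finsupp.lmapDomain k k (fun φ : E ⟶ X => φ ≫ Q) := by
    refine Finsupp.lhom_ext' fun φ => LinearMap.ext_ring ?_
    change F.map Q (genMap g X (Finsupp.single φ 1)) =
      genMap g Y (Finsupp.lmapDomain k k (fun φ : E ⟶ X => φ ≫ Q) (Finsupp.single φ 1))
    rw [Finsupp.lmapDomain_apply, Finsupp.mapDomain_single, genMap_single, genMap_single,
      Functor.map_comp]
    rfl
  exact LinearMap.congr_fun h u

/-- A functor is generated by `g` if all its elements are combinations of images of `g`. -/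
def Generates (g : F.obj E) : Prop :=
  ∀ X : FinCorr.{u}, Function.Surjective (genMap g X)

lemma Generates.hom_ext {g : F.obj E} (hg : Generates g) {θ θ' : F ⟶ F'}
    (h : θ.app E g = θ'.app E g) : θ = θ' := by
  ext X x
  obtain ⟨u, rfl⟩ := hg X x
  change θ.app X _ = θ'.app X _
  rw [app_genMap, app_genMap, h]

/-- Each `F(X)` is the quotient of `k𝒞(X,E)` by the kernel of its presentation, so the inclusion of
kernels gives the maps. They are natural because both presentations commute with composition by `Q`.
-/
lemma Generates.exists_hom {g : F.obj E} (hg : Generates g) (g' : F'.obj E)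
    (h : ∀ (X : FinCorr.{u}) (u : (E ⟶ X) →₀ k), genMap g X u = 0 → genMap g' X u = 0) :
    ∃ θ : F ⟶ F', θ.app E g = g' := by
  have hle : ∀ X, LinearMap.ker (genMap g X) ≤ LinearMap.ker (genMap g' X) := fun X u hu => h X u hu
  let f (X : FinCorr.{u}) : F.obj X →ₗ[k] F'.obj X :=
    (LinearMap.ker (genMap g X)).liftQ (genMap g' X) (hle X) ∘ₗ
      ((genMap g X).quotKerEquivOfSurjective (hg X)).symm.toLinearMap
  have hf : ∀ (X : FinCorr.{u}) (u : (E ⟶ X) →₀ k), f X (genMap g X u) = genMap g' X u := by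
    intro X u
    have h1 : ((genMap g X).quotKerEquivOfSurjective (hg X)).symm (genMap g X u) =
        (LinearMap.ker (genMap g X)).mkQ u := by
      rw [LinearEquiv.symm_apply_eq]
      rfl
    change (LinearMap.ker (genMap g X)).liftQ _ (hle X)
      (((genMap g X).quotKerEquivOfSurjective (hg X)).symm (genMap g X u)) = _
    rw [h1]
    rfl
  refine ⟨{ app := fun X => ModuleCat.ofHom (f X), naturality := fun X Y Q => ?_ }, ?_⟩
  · ext x
    obtain ⟨u, rfl⟩ := hg X x
    change f Y (F.map Q (genMap g X u)) = F'.map Q (f X (genMap g X u))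
    rw [map_genMap, hf, hf, map_genMap]
  · change f E g = g'
    have h1 : ∀ {G : CorrFunctor.{u} k} (x : G.obj E),
        genMap x E (Finsupp.single (𝟙 E) 1) = x := by
      intro G x
      rw [genMap_single, CategoryTheory.Functor.map_id]
      rfl
    rw [← h1 g, hf, h1]

lemma exists_iso_of_bijective (θ : F ⟶ F') (h : ∀ X, Function.Bijective (θ.app X)) :
    ∃ i : F ≅ F', i.hom = θ := by
  have h1 : ∀ X, IsIso (θ.app X) := fun X =>
    (ConcreteCategory.isIso_iff_bijective (θ.app X)).2 (h X)
  have h2 : IsIso θ := NatIso.isIso_of_isIso_app θ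
  exact ⟨asIso θ, rfl⟩

lemma Generates.surjective {g' : F'.obj E} (hg' : Generates g') (θ : F ⟶ F') (g : F.obj E)
    (h : θ.app E g = g') (X : FinCorr.{u}) : Function.Surjective (θ.app X) := by
  intro x
  obtain ⟨u, rfl⟩ := hg' X x
  exact ⟨genMap g X u, by rw [app_genMap, h]⟩

lemma Generates.exists_iso {g : F.obj E} {g' : F'.obj E} (hg : Generates g) (hg' : Generates g')
    (h : ∀ (X : FinCorr.{u}) (u : (E ⟶ X) →₀ k), genMap g X u = 0 ↔ genMap g' X u = 0) :
    ∃ i : F ≅ F', i.hom.app E g = g' := by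
  obtain ⟨θ, hθ⟩ := hg.exists_hom g' fun X u => (h X u).1
  obtain ⟨i, hi⟩ := exists_iso_of_bijective θ fun X => by
    refine ⟨?_, hg'.surjective θ g hθ X⟩
    refine (injective_iff_map_eq_zero (θ.app X).hom).2 fun x hx => ?_
    obtain ⟨u, rfl⟩ := hg X x
    change θ.app X _ = 0 at hx
    rw [app_genMap, hθ] at hx
    exact (h X u).2 hx
  exact ⟨i, by rw [hi, hθ]⟩

lemma generates_gen (g : F.obj E) :
    Generates (F := (Sub.gen g).toFunctor) (⟨g, Sub.mem_gen g⟩ : (Sub.gen g).obj E) := by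
  rintro X ⟨x, hx⟩
  have h : x ∈ Submodule.span k (Set.range fun Q : E ⟶ X => F.map Q g) := hx
  rw [Finsupp.mem_span_range_iff_exists_finsupp] at h
  obtain ⟨u, hu⟩ := h
  refine ⟨u, Subtype.ext ?_⟩
  have h1 := app_genMap (Sub.gen g).incl (⟨g, Sub.mem_gen g⟩ : (Sub.gen g).obj E) X u
  exact h1.trans hu

/-- The bilinear form with `(ψ, φ) ↦ 1` if `ψφ` is straight and `0` otherwise, at a fixed `ψ`. -/
def straightPairing (k : Type v) [CommRing k] (R : OrderOn E) {X : FinCorr.{u}} (ψ : X ⟶ E) :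
    ((E ⟶ X) →₀ k) →ₗ[k] k :=
  open Classical in
  Finsupp.linearCombination k fun φ : E ⟶ X => if Straight R (φ ≫ ψ : E ⟶ E) then (1 : k) else 0

open Classical in
lemma straightPairing_single (R : OrderOn E) {X : FinCorr.{u}} (ψ : X ⟶ E) (φ : E ⟶ X) :
    straightPairing k R ψ (Finsupp.single φ 1) =
      if Straight R (φ ≫ ψ : E ⟶ E) then (1 : k) else 0 := by
  simp [straightPairing]

end Generated

/-! ### The fundamental functors -/

section Fundamental

variable {k : Type v} [CommRing k] {E : FinCorr.{u}} (R : OrderOn E)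

/-- The generator of the fundamental functor. -/
def fundGen (k : Type v) [CommRing k] (R : OrderOn E) : (fundFunctor k R).obj E :=
  fundEval k R (fGen k R)

lemma permOrderMk_span : Submodule.span k (Set.range (permOrderMk k E)) = ⊤ := by
  rw [eq_top_iff]
  rintro x -
  obtain ⟨a, rfl⟩ := RingQuot.mkAlgHom_surjective k (PermOrderRel k E) x
  induction a using MonoidAlgebra.induction_on with
  | of Q => exact Submodule.subset_span ⟨Q, rfl⟩
  | add a b ha hb => rw [map_add]; exact Submodule.add_mem _ ha hb
  | smul c a ha => rw [map_smul]; exact Submodule.smul_mem _ c ha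

lemma fundMod_span :
    Submodule.span k (Set.range fun Q : End E => fundRep k R Q (fGen k R)) = ⊤ := by
  rw [eq_top_iff]
  rintro ⟨w, hw⟩ -
  obtain ⟨a, rfl⟩ := Ideal.mem_span_singleton'.1 hw
  have ha : a ∈ Submodule.span k (Set.range (permOrderMk k E)) := by
    rw [permOrderMk_span]; trivial
  let f : PermOrderAlg k E →ₗ[k] FundMod k R :=
    (LinearMap.toSpanSingleton (PermOrderAlg k E) (FundMod k R) (fGen k R)).restrictScalars k
  have h : (f a) ∈ Submodule.span k (Set.range fun Q : End E => fundRep k R Q (fGen k R)) := by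
    have := Submodule.mem_map_of_mem (f := f) ha
    rw [Submodule.map_span, ← Set.range_comp] at this
    exact this
  exact h

open Classical in
lemma fundRep_fGen (Q : End E) :
    letI := Fintype.ofFinite E
    fundRep k R Q (fGen k R) = ∑ σ : Equiv.Perm E,
      if Straight R (permRel σ⁻¹ * Q) then fundRep k R (permRel σ) (fGen k R) else 0 := by
  apply Subtype.ext
  let _ := Fintype.ofFinite E
  have h := permOrderMk_mul_fIdem (k := k) Q R
  rw [AddSubmonoidClass.coe_finsetSum]
  refine h.trans (Finset.sum_congr rfl fun σ _ => ?_)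
  split_ifs
  · rfl
  · rfl

/-- The fundamental module is spanned by the images of its generator under permutations. -/
lemma fundMod_span_perm :
    Submodule.span k (Set.range fun σ : Equiv.Perm E =>
      fundRep k R (permRel σ) (fGen k R)) = ⊤ := by
  rw [eq_top_iff, ← fundMod_span, Submodule.span_le]
  rintro _ ⟨Q, rfl⟩
  dsimp only
  rw [SetLike.mem_coe, fundRep_fGen]
  refine Submodule.sum_mem _ fun σ _ => ?_
  split_ifs
  · exact Submodule.subset_span ⟨σ, rfl⟩
  · exact Submodule.zero_mem _

lemma tmul_eq_map {X : FinCorr.{u}} (φ : E ⟶ X) (Q : End E) (w : FundMod k R) :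
    LFun.tmul (fundRep k R) φ (fundRep k R Q w) = LFun.tmul (fundRep k R) (Q ≫ φ : E ⟶ X) w := by
  symm
  refine (Submodule.Quotient.eq _).2 (Submodule.subset_span ⟨φ, Q, w, rfl⟩)

lemma map_tmul {X : FinCorr.{u}} (φ : E ⟶ X) (w : FundMod k R) :
    (LFun (fundRep k R)).map φ (LFun.tmul (fundRep k R) (𝟙 E) w) =
      LFun.tmul (fundRep k R) φ w := by
  change (balanced (fundRep k R) X).mkQ (postcomp k E _ φ (Finsupp.single (𝟙 E) w)) = _
  rw [postcomp_single, Category.id_comp]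
  rfl

lemma proj_tmul_eq {X : FinCorr.{u}} (φ : E ⟶ X) (w : FundMod k R) :
    (JSub (fundRep k R)).proj.app X (LFun.tmul (fundRep k R) φ w) =
      (fundFunctor k R).map φ (fundEval k R w) := by
  rw [← map_tmul]
  rfl

lemma map_fundGen {X : FinCorr.{u}} (φ : E ⟶ X) (Q : End E) :
    (fundFunctor k R).map φ (fundEval k R (fundRep k R Q (fGen k R))) =
      (fundFunctor k R).map (Q ≫ φ : E ⟶ X) (fundGen k R) := by
  rw [← proj_tmul_eq, tmul_eq_map, proj_tmul_eq]
  rfl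

/-- The map `w ↦ φ ⊗ w`. -/
def tmulLin {X : FinCorr.{u}} (φ : E ⟶ X) : FundMod k R →ₗ[k] (LFun (fundRep k R)).obj X :=
  (balanced (fundRep k R) X).mkQ ∘ₗ Finsupp.lsingle φ

lemma generates_fundGen : Generates (fundGen k R) := by
  intro X
  let p : ((E ⟶ X) →₀ FundMod k R) →ₗ[k] (fundFunctor k R).obj X :=
    ((JSub (fundRep k R)).proj.app X).hom ∘ₗ (balanced (fundRep k R) X).mkQ
  have hp : Function.Surjective p :=
    (Submodule.mkQ_surjective ((JSub (fundRep k R)).obj X)).comp (Submodule.mkQ_surjective _)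
  rw [← LinearMap.range_eq_top, eq_top_iff, ← LinearMap.range_eq_top.2 hp]
  rintro _ ⟨z, rfl⟩
  induction z using Finsupp.induction_linear with
  | zero => rw [map_zero]; exact Submodule.zero_mem _
  | add a b ha hb => rw [map_add]; exact Submodule.add_mem _ ha hb
  | single φ w =>
    have hw : w ∈ Submodule.span k (Set.range fun Q : End E => fundRep k R Q (fGen k R)) := by
      rw [fundMod_span]; trivial
    refine (Submodule.span_le (p := (LinearMap.range (genMap (fundGen k R) X)).comap
      (p ∘ₗ Finsupp.lsingle φ))).2 ?_ hw
    rintro _ ⟨Q, rfl⟩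
    refine ⟨Finsupp.single (Q ≫ φ : E ⟶ X) 1, ?_⟩
    rw [genMap_single, ← map_fundGen, ← proj_tmul_eq]
    rfl

lemma fundMod_eq_zero_iff (a : PermOrderAlg k E) :
    a * fIdem k R = 0 ↔
      ∀ σ : Equiv.Perm E,
        straightForm k R (permOrderMk k E (permRel σ⁻¹) * a * fIdem k R) = 0 := by
  constructor
  · intro h σ
    rw [mul_assoc, h, mul_zero, map_zero]
  · intro h
    classical
    let _ := Fintype.ofFinite E
    -- The coefficient of `Δ_σ f_R` in `a f_R` is that of `f_R` after translation by `Δ_σ⁻¹`. By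
    -- linearity it suffices to check this for the class of a relation.
    have key : ∀ a : PermOrderAlg k E, a * fIdem k R = ∑ σ : Equiv.Perm E,
        straightForm k R (permOrderMk k E (permRel σ⁻¹) * a * fIdem k R) •
          (permOrderMk k E (permRel σ) * fIdem k R) := by
      intro a
      have ha : a ∈ Submodule.span k (Set.range (permOrderMk k E)) := by
        rw [permOrderMk_span]; trivial
      induction ha using Submodule.span_induction with
      | mem x hx =>
        obtain ⟨Q, rfl⟩ := hx
        rw [permOrderMk_mul_fIdem]
        refine Finset.sum_congr rfl fun σ _ => ?_
        rw [← map_mul, straightForm_mul_fIdem]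
        split_ifs <;> simp
      | zero => simp
      | add x y _ _ hx hy =>
        simp only [mul_add, add_mul, map_add, add_smul, Finset.sum_add_distrib]
        rw [hx, hy]
      | smul c x _ hx =>
        simp only [mul_smul_comm, smul_mul_assoc, map_smul, smul_assoc]
        rw [hx, Finset.smul_sum]
    rw [key]
    exact Finset.sum_eq_zero fun σ _ => by rw [h σ, zero_smul]

/-- The kernel of the presentation `k𝒞(X,E) → 𝕊_{E,R}(X)` is the radical of the straight form. -/
lemma genMap_fundGen_eq_zero_iff {X : FinCorr.{u}} (u : (E ⟶ X) →₀ k) :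
    genMap (fundGen k R) X u = 0 ↔ ∀ ψ : X ⟶ E, straightPairing k R ψ u = 0 := by
  let ev (ψ : X ⟶ E) : ((E ⟶ X) →₀ k) →ₗ[k] PermOrderAlg k E :=
    Finsupp.linearCombination k fun φ : E ⟶ X => permOrderMk k E (φ ≫ ψ : E ⟶ E)
  have hev : ∀ (ψ : X ⟶ E) (φ : E ⟶ X), ev ψ (Finsupp.single φ 1) =
      permOrderMk k E (φ ≫ ψ : E ⟶ E) := fun ψ φ => by simp [ev]
  let lift : ((E ⟶ X) →₀ k) →ₗ[k] (LFun (fundRep k R)).obj X :=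
    Finsupp.linearCombination k fun φ : E ⟶ X => LFun.tmul (fundRep k R) φ (fGen k R)
  have hlift : ∀ φ : E ⟶ X, lift (Finsupp.single φ 1) = LFun.tmul (fundRep k R) φ (fGen k R) :=
    fun φ => by simp [lift]
  have h1 : genMap (fundGen k R) X = ((JSub (fundRep k R)).proj.app X).hom ∘ₗ lift := by
    refine Finsupp.lhom_ext' fun φ => LinearMap.ext_ring ?_
    refine (genMap_single (fundGen k R) φ).trans ((proj_tmul_eq R φ (fGen k R)).symm.trans ?_)
    rw [← hlift]
    rfl
  have h2 : ∀ ψ : X ⟶ E, ∀ u, (LFun.eval (fundRep k R) ψ (lift u) : PermOrderAlg k E) =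
      ev ψ u * fIdem k R := by
    intro ψ u
    have h : (Submodule.subtype (Ideal.span {fIdem k R})).restrictScalars k ∘ₗ
        LFun.eval (fundRep k R) ψ ∘ₗ lift = LinearMap.mulRight k (fIdem k R) ∘ₗ ev ψ := by
      refine Finsupp.lhom_ext' fun φ => LinearMap.ext_ring ?_
      change ((LFun.eval (fundRep k R) ψ (lift (Finsupp.single φ 1)) : FundMod k R) :
        PermOrderAlg k E) = ev ψ (Finsupp.single φ 1) * fIdem k R
      rw [hlift, hev, LFun.eval_tmul]
      rfl
    exact LinearMap.congr_fun h u
  have h3 : ∀ (ψ : X ⟶ E) (σ : Equiv.Perm E) (u), permOrderMk k E (permRel σ) * ev ψ u =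
      ev (ψ ≫ permRel σ) u := by
    intro ψ σ u
    have h : LinearMap.mulLeft k (permOrderMk k E (permRel σ)) ∘ₗ ev ψ =
        ev (ψ ≫ permRel σ) := by
      refine Finsupp.lhom_ext' fun φ => LinearMap.ext_ring ?_
      change permOrderMk k E (permRel σ) * ev ψ (Finsupp.single φ 1) = ev _ (Finsupp.single φ 1)
      rw [hev, hev, ← map_mul, ← Category.assoc]
      rfl
    exact LinearMap.congr_fun h u
  have h4 : ∀ (ψ : X ⟶ E) (u), straightForm k R (ev ψ u * fIdem k R) =
      straightPairing k R ψ u := by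
    intro ψ u
    have h : straightForm k R ∘ₗ LinearMap.mulRight k (fIdem k R) ∘ₗ ev ψ =
        straightPairing k R ψ := by
      classical
      refine Finsupp.lhom_ext' fun φ => LinearMap.ext_ring ?_
      change straightForm k R (ev ψ (Finsupp.single φ 1) * fIdem k R) =
        straightPairing k R ψ (Finsupp.single φ 1)
      rw [hev, straightForm_mul_fIdem, straightPairing_single]
    exact LinearMap.congr_fun h u
  have h5 : genMap (fundGen k R) X u = 0 ↔ ∀ ψ : X ⟶ E, ev ψ u * fIdem k R = 0 := by
    rw [h1]
    refine (Submodule.Quotient.mk_eq_zero ((JSub (fundRep k R)).obj X)).trans ?_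
    refine (Submodule.mem_iInf _).trans (forall_congr' fun ψ => ?_)
    rw [LinearMap.mem_ker, ← h2]
    exact ⟨fun h => congrArg Subtype.val h, fun h => Subtype.ext h⟩
  rw [h5]
  constructor
  · intro h ψ
    rw [← h4, h, map_zero]
  · intro h ψ
    -- Since `Δ_σ⁻¹ ψ` is again a correspondence from `X` to `E`, letting `ψ` vary tests every
    -- coefficient, not only that of `f_R`.
    rw [fundMod_eq_zero_iff]
    intro σ
    rw [h3, h4, h]

lemma fundEval_fundRep (Q : End E) :
    fundEval k R (fundRep k R Q (fGen k R)) = (fundFunctor k R).map Q (fundGen k R) := by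
  have h := map_fundGen (k := k) R (𝟙 E) Q
  rwa [CategoryTheory.Functor.map_id, Category.comp_id] at h

/-- A linear form on `𝕊_{E,R}(E)` is determined by its values on the `Δ_σ f_R`. -/
lemma dual_fundFunctor_ext {α α' : (dual (fundFunctor k R)).obj E}
    (h : ∀ σ : Equiv.Perm E,
      dualApply α (fundEval k R (fundRep k R (permRel σ) (fGen k R))) =
        dualApply α' (fundEval k R (fundRep k R (permRel σ) (fGen k R)))) : α = α' := by
  refine LinearMap.ext fun x => ?_
  obtain ⟨u, rfl⟩ := generates_fundGen R E x
  let a : Module.Dual k ((fundFunctor k R).obj E) := α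
  let a' : Module.Dual k ((fundFunctor k R).obj E) := α'
  let f : FundMod k R →ₗ[k] (fundFunctor k R).obj E :=
    ((JSub (fundRep k R)).proj.app E).hom ∘ₗ tmulLin R (𝟙 E)
  have h1 : a ∘ₗ f = a' ∘ₗ f := by
    refine LinearMap.ext_on_range (fundMod_span_perm R) h
  change (a ∘ₗ genMap (fundGen k R) E) u = (a' ∘ₗ genMap (fundGen k R) E) u
  congr 1
  refine Finsupp.lhom_ext' fun Q => LinearMap.ext_ring ?_
  change a (genMap (fundGen k R) E (Finsupp.single Q 1)) =
    a' (genMap (fundGen k R) E (Finsupp.single Q 1))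
  rw [genMap_single, ← fundEval_fundRep]
  exact LinearMap.congr_fun h1 (fundRep k R Q (fGen k R))

end Fundamental

/-! ### The functor of a lattice and its generator -/

section Lattice

variable {k : Type v} [CommRing k] {T : Type u} [Lattice T] [BoundedOrder T]

lemma FT.map_of {X Y : FinCorr.{u}} (Q : X ⟶ Y) (φ : X → T) :
    (FT k T).map Q (FT.of k φ) = FT.of k (act Q φ) :=
  Finsupp.mapDomain_single

/-- The coefficient of a map in an element of `F_T(X)`. -/
def FT.coeff (k : Type v) [CommRing k] {T : Type u} [Lattice T] [BoundedOrder T]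
    {X : FinCorr.{u}} (φ : X → T) : (FT k T).obj X →ₗ[k] k :=
  Finsupp.lapply φ

open Classical in
lemma FT.coeff_of {X : FinCorr.{u}} (φ ψ : X → T) :
    FT.coeff k φ (FT.of k ψ) = if ψ = φ then 1 else 0 :=
  Finsupp.single_apply

lemma FT.lhom_ext {X : FinCorr.{u}} {M : Type*} [AddCommGroup M] [Module k M]
    {f g : (FT k T).obj X →ₗ[k] M} (h : ∀ φ : X → T, f (FT.of k φ) = g (FT.of k φ)) : f = g :=
  Finsupp.lhom_ext' fun φ => LinearMap.ext_ring (h φ)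

open Classical in
lemma pairing_of_of {X : FinCorr.{u}} (φ : X → T) (ψ : X → Tᵒᵈ) :
    pairing k T X (FT.of k φ) (FT.of k ψ) =
      if ∀ x, φ x ≤ OrderDual.ofDual (ψ x) then 1 else 0 := by
  change prePairing k T X (Finsupp.single φ 1) (Finsupp.single ψ 1) = _
  simp [prePairing]

variable [Finite T]

/-! ### Perfectness of the form between `F_T` and `F_{T^op}` -/

open Classical in
lemma pairing_of_apply {X : FinCorr.{u}} (φ : X → T) (w : (X → Tᵒᵈ) →₀ k) :
    letI := Fintype.ofFinite (X → T)
    pairing k T X (FT.of k φ) w =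
      ∑ ψ : X → T, if φ ≤ ψ then w (fun x => OrderDual.toDual (ψ x)) else 0 := by
  let _ := Fintype.ofFinite (X → T)
  have h : ∀ w : (X → Tᵒᵈ) →₀ k, prePairing k T X (Finsupp.single φ 1) w =
      ∑ ψ : X → T, if φ ≤ ψ then w (fun x => OrderDual.toDual (ψ x)) else 0 := by
    intro w
    simp only [prePairing, Finsupp.linearCombination_single, one_smul]
    let _ : Fintype (X → Tᵒᵈ) := Fintype.ofFinite (X → T)
    rw [Finsupp.linearCombination_apply, Finsupp.sum_fintype _ _ fun _ => by simp]
    let e : (X → Tᵒᵈ) ≃ (X → T) := Equiv.refl _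
    refine Fintype.sum_equiv e _ _ fun ψ => ?_
    rw [smul_eq_mul, mul_ite, mul_one, mul_zero]
    rfl
  exact h w

/-- The matrix of the form is unitriangular for the pointwise order on maps `X → T`, so the
coefficients of `w` vanish by induction from larger maps to smaller ones. -/
lemma pairing_injective {X : FinCorr.{u}} (w : (FT k Tᵒᵈ).obj X)
    (h : ∀ φ : X → T, pairing k T X (FT.of k φ) w = 0) : w = 0 := by
  classical
  let _ := Fintype.ofFinite (X → T)
  let w' : (X → Tᵒᵈ) →₀ k := w
  have key : ∀ ψ : X → T, w' (fun x => OrderDual.toDual (ψ x)) = 0 := by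
    intro φ
    induction φ using (wellFounded_gt (α := X → T)).induction with
    | _ φ ih =>
    have h1 := (pairing_of_apply φ w').symm.trans (h φ)
    rwa [Finset.sum_eq_single φ, if_pos le_rfl] at h1
    · intro ψ _ hne
      split_ifs with hle
      · exact ih ψ (lt_of_le_of_ne hle hne.symm)
      · rfl
    · simp
  exact Finsupp.ext key

lemma pairing_surjective {X : FinCorr.{u}} (f : (FT k T).obj X →ₗ[k] k) :
    ∃ w : (FT k Tᵒᵈ).obj X, ∀ u, pairing k T X u w = f u := by
  classical
  let _ := Fintype.ofFinite (X → T)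
  let _ : LocallyFiniteOrder (X → T) := Fintype.toLocallyFiniteOrder
  -- The solution of `∑_{ψ ≥ φ} w(ψ) = f(φ)` given by Möbius inversion.
  let w : (X → Tᵒᵈ) →₀ k := Finsupp.equivFunOnFinite.symm fun ψ =>
    ∑ χ : X → T, IncidenceAlgebra.mu k (fun x => OrderDual.ofDual (ψ x)) χ * f (FT.of k χ)
  refine ⟨w, fun u => ?_⟩
  have h : (pairing k T X).flip w = f := by
    refine FT.lhom_ext fun φ => ?_
    refine (pairing_of_apply φ w).trans ?_
    have h1 : ∀ ψ : X → T, (if φ ≤ ψ then w (fun x => OrderDual.toDual (ψ x)) else 0) =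
        ∑ χ : X → T, (if φ ≤ ψ ∧ ψ ≤ χ then IncidenceAlgebra.mu k ψ χ else 0) *
          f (FT.of k χ) := by
      intro ψ
      split_ifs with hle
      · refine Finset.sum_congr rfl fun χ _ => ?_
        congr 1
        by_cases hχ : ψ ≤ χ
        · rw [if_pos ⟨hle, hχ⟩]; rfl
        · rw [if_neg fun h => hχ h.2]
          exact IncidenceAlgebra.apply_eq_zero_of_not_le hχ _
      · symm
        exact Finset.sum_eq_zero fun χ _ => by rw [if_neg fun h => hle h.1, zero_mul]
    rw [Finset.sum_congr rfl fun ψ _ => h1 ψ, Finset.sum_comm]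
    have h2 : ∀ χ : X → T, (∑ ψ : X → T, if φ ≤ ψ ∧ ψ ≤ χ then
        IncidenceAlgebra.mu k ψ χ else 0) = if φ = χ then 1 else 0 := by
      intro χ
      rw [← IncidenceAlgebra.sum_Icc_mu_left φ χ, ← Finset.sum_filter]
      refine Finset.sum_congr ?_ fun _ _ => rfl
      ext ψ
      simp
    simp_rw [← Finset.sum_mul, h2]
    simp
  exact LinearMap.congr_fun h u

/-! ### The element `γ_T` and the generator `ι` -/

lemma rJoin_lt {e : T} (he : SupIrred e) : rJoin e < e := by
  refine lt_of_le_of_ne (Finset.sup_le fun s hs => ?_) fun h => ?_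
  · exact ((Set.Finite.mem_toFinset _).1 hs).le
  · obtain ⟨s, hs, h1⟩ := he.finset_sup_eq h
    exact ((Set.Finite.mem_toFinset _).1 hs).ne h1

lemma le_rJoin {s t : T} (h : s < t) : s ≤ rJoin t :=
  Finset.le_sup (f := id) ((Set.Finite.mem_toFinset _).2 h)

/-- Pairing with `γ_T` gives the coefficient of the inclusion `E → T`. -/
lemma pairing_gammaT (u : (FT k T).obj (irr T)) :
    pairing k T (irr T) u (gammaT T k) = FT.coeff k (irrIncl T) u := by
  classical
  have h : (pairing k T (irr T)).flip (gammaT T k) = FT.coeff k (irrIncl T) := by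
    refine FT.lhom_ext fun φ => ?_
    rw [LinearMap.flip_apply, FT.coeff_of]
    let _ := Fintype.ofFinite (irr T)
    let a : irr T → k := fun e => if φ e ≤ rJoin e.1 then 1 else 0
    let b : irr T → k := fun e => if φ e ≤ e.1 then 1 else 0
    have h1 : ∀ A : Finset (irr T),
        pairing k T (irr T) (FT.of k φ) (FT.of k fun e => OrderDual.toDual (eta T A e)) =
          (∏ e ∈ A, a e) * ∏ e ∈ Finset.univ \ A, b e := by
      intro A
      rw [pairing_of_of, Finset.prod_boole, Finset.prod_boole, ite_zero_mul_ite_zero, mul_one]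
      have h2 : (∀ e, φ e ≤ eta T A e) ↔
          (∀ e ∈ A, φ e ≤ rJoin e.1) ∧ ∀ e ∈ Finset.univ \ A, φ e ≤ e.1 := by
        simp only [eta, Finset.mem_sdiff, Finset.mem_univ, true_and]
        constructor
        · intro h
          exact ⟨fun e he => by simpa [he] using h e, fun e he => by simpa [he] using h e⟩
        · rintro ⟨h2, h3⟩ e
          split_ifs with he
          · exact h2 e he
          · exact h3 e he
      by_cases h : ∀ e, φ e ≤ eta T A e
      · exact (if_pos h).trans (if_pos (h2.1 h)).symm
      · exact (if_neg h).trans (if_neg fun h3 => h (h2.2 h3)).symm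
    -- The form is a product over `E`, so the alternating sum over `A` is the expansion of `∏ (b e -
    -- a e)`.
    have h2 : pairing k T (irr T) (FT.of k φ) (gammaT T k) = ∏ e : irr T, (-a e + b e) := by
      rw [Finset.prod_add, Finset.powerset_univ, gammaT, map_sum]
      refine Finset.sum_congr (by ext; simp) fun A _ => ?_
      rw [map_smul, h1, Finset.prod_neg, smul_eq_mul, mul_assoc]
    -- An element is strictly below `e` exactly when it is below `r(e)`, so `b e - a e` detects
    -- equality with `e`.
    have h3 : ∀ e : irr T, -a e + b e = if φ e = irrIncl T e then 1 else 0 := by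
      intro e
      have hlt : rJoin e.1 < e.1 := rJoin_lt e.2
      by_cases he : φ e = e.1
      · simp [a, b, he, irrIncl, hlt.not_ge]
      · by_cases hle : φ e ≤ e.1
        · have := le_rJoin (lt_of_le_of_ne hle he)
          simp [a, b, he, irrIncl, hle, this]
        · have : ¬ φ e ≤ rJoin e.1 := fun h => hle (h.trans hlt.le)
          simp [a, b, he, irrIncl, hle, this]
    rw [h2, Finset.prod_congr rfl fun e _ => h3 e, Finset.prod_boole]
    by_cases hφ : φ = irrIncl T
    · rw [if_pos hφ, if_pos fun e _ => congrFun hφ e]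
    · rw [if_neg hφ, if_neg fun h => hφ (funext fun e => h e (Finset.mem_univ e))]
  exact LinearMap.congr_fun h u

/-- Every element of a finite lattice is the join of the irreducible elements below it. Hence `ι`
generates `F_T`. -/
lemma exists_act_irrIncl {X : FinCorr.{u}} (φ : X → T) :
    ∃ Q : irr T ⟶ X, act Q (irrIncl T) = φ := by
  refine ⟨toHom {p | p.2.1 ≤ φ p.1}, ?_⟩
  funext x
  apply le_antisymm
  · rw [act_le]
    exact fun e he => he
  · obtain ⟨s, hs, hirr⟩ := exists_supIrred_decomposition (φ x)
    rw [← hs]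
    refine Finset.sup_le fun e he => ?_
    exact (act_le _ (irrIncl T) x _).1 le_rfl ⟨e, hirr he⟩
      (show e ≤ φ x from hs ▸ Finset.le_sup (f := id) he)

/-- A join of elements equals the irreducible `e` only if `e` is one of them, which forces
reflexivity; the other elements must lie below `e`, which is containment in `R^op`. -/
lemma act_irrIncl_eq_iff (Q : irr T ⟶ irr T) :
    act Q (irrIncl T) = irrIncl T ↔ Straight (irrOrder T).op Q := by
  constructor
  · intro h
    refine ⟨fun e => ?_, fun e x hx => ?_⟩
    · obtain ⟨x, hx, h1⟩ := SupIrred.finset_sup_eq e.2 (congrFun h e)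
      have h2 : (e, x) ∈ relOf Q :=
        (Set.toFinite {x : irr T | (e, x) ∈ relOf Q}).mem_toFinset.1 hx
      obtain rfl : x = e := Subtype.ext h1
      exact h2
    · exact (act_le Q (irrIncl T) e _).1 (congrFun h e).le x hx
  · rintro ⟨h1, h2⟩
    funext e
    apply le_antisymm
    · rw [act_le]
      exact fun x hx => h2 e x hx
    · exact (act_le Q (irrIncl T) e _).1 le_rfl e (h1 e)

lemma straight_permRel_iff {E : FinCorr.{u}} (R : OrderOn E) (σ : Equiv.Perm E) :
    Straight R (permRel σ) ↔ σ = 1 := by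
  constructor
  · intro h
    ext a
    exact (h.1 a).symm
  · rintro rfl
    exact ⟨fun _ => rfl, fun a b h => (show a = b from h) ▸ R.2.1 a⟩

lemma generates_irrIncl : Generates (FT.of k (irrIncl T)) := by
  intro X
  rw [← LinearMap.range_eq_top, eq_top_iff]
  rintro x -
  have hx : ∀ u : (X → T) →₀ k, u ∈ (LinearMap.range (genMap (FT.of k (irrIncl T)) X)) := by
    intro u
    induction u using Finsupp.induction_linear with
    | zero => exact Submodule.zero_mem _
    | add a b ha hb => exact Submodule.add_mem _ ha hb
    | single φ c =>
      obtain ⟨Q, rfl⟩ := exists_act_irrIncl φ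
      have h1 : FT.of k (act Q (irrIncl T)) ∈ LinearMap.range (genMap (FT.of k (irrIncl T)) X) :=
        ⟨Finsupp.single Q 1, by rw [genMap_single, FT.map_of]⟩
      rw [← mul_one c, ← smul_eq_mul, ← Finsupp.smul_single]
      exact Submodule.smul_mem _ c h1
  exact hx x

lemma coeff_map_genMap {X : FinCorr.{u}} (ψ : X ⟶ irr T) (u : (irr T ⟶ X) →₀ k) :
    FT.coeff k (irrIncl T) ((FT k T).map ψ (genMap (FT.of k (irrIncl T)) X u)) =
      straightPairing k (irrOrder T).op ψ u := by
  classical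
  have h : FT.coeff k (irrIncl T) ∘ₗ ((FT k T).map ψ).hom ∘ₗ genMap (FT.of k (irrIncl T)) X =
      straightPairing k (irrOrder T).op ψ := by
    refine Finsupp.lhom_ext' fun φ => LinearMap.ext_ring ?_
    change FT.coeff k (irrIncl T) ((FT k T).map ψ (genMap _ X (Finsupp.single φ 1))) =
      straightPairing k (irrOrder T).op ψ (Finsupp.single φ 1)
    rw [genMap_single, FT.map_of, FT.map_of, FT.coeff_of, straightPairing_single, ← act_comp]
    exact if_congr (act_irrIncl_eq_iff _) rfl rfl
  exact LinearMap.congr_fun h u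

lemma pairing_map_gammaT {X : FinCorr.{u}} (Q : irr T ⟶ X) (u : (FT k T).obj X) :
    pairing k T X u ((FT k Tᵒᵈ).map Q (gammaT T k)) =
      FT.coeff k (irrIncl T) ((FT k T).map (opCorr Q) u) := by
  rw [pairing_map, pairing_gammaT]

/-- The two composites are opposite to each other. This symmetry is the source of `R^op` for `F_T`
against `R` for `⟨γ_T⟩`. -/
lemma straight_op_comp_opCorr {E X : FinCorr.{u}} (R : OrderOn E) (P Q : E ⟶ X) :
    Straight R.op (P ≫ opCorr Q : E ⟶ E) ↔ Straight R (Q ≫ opCorr P : E ⟶ E) := by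
  constructor
  · rintro ⟨h1, h2⟩
    refine ⟨fun a => ?_, ?_⟩
    · obtain ⟨x, h3, h4⟩ := h1 a
      exact ⟨x, h4, h3⟩
    · rintro a b ⟨x, h3, h4⟩
      exact h2 b a ⟨x, h4, h3⟩
  · rintro ⟨h1, h2⟩
    refine ⟨fun a => ?_, ?_⟩
    · obtain ⟨x, h3, h4⟩ := h1 a
      exact ⟨x, h4, h3⟩
    · rintro a b ⟨x, h3, h4⟩
      exact h2 b a ⟨x, h4, h3⟩

lemma pairing_genMap_gammaT {X : FinCorr.{u}} (P : irr T ⟶ X) (u : (irr T ⟶ X) →₀ k) :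
    pairing k T X (FT.of k (act P (irrIncl T))) (genMap (gammaT T k) X u) =
      straightPairing k (irrOrder T) (opCorr P) u := by
  classical
  have h : pairing k T X (FT.of k (act P (irrIncl T))) ∘ₗ genMap (gammaT T k) X =
      straightPairing k (irrOrder T) (opCorr P) := by
    refine Finsupp.lhom_ext' fun Q => LinearMap.ext_ring ?_
    change pairing k T X (FT.of k (act P (irrIncl T)))
      (genMap (gammaT T k) X (Finsupp.single Q 1)) =
        straightPairing k (irrOrder T) (opCorr P) (Finsupp.single Q 1)
    rw [genMap_single, pairing_map_gammaT, FT.map_of, FT.coeff_of, straightPairing_single,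
      ← act_comp]
    exact if_congr ((act_irrIncl_eq_iff _).trans (straight_op_comp_opCorr _ P Q)) rfl rfl
  exact LinearMap.congr_fun h u

/-- The maps `P ι` exhaust all maps `X → T` and the form is nondegenerate, so an element vanishes
once it pairs to zero with each of them. The same radical describes `𝕊_{E,R}`. -/
lemma genMap_gammaT_eq_zero_iff {X : FinCorr.{u}} (u : (irr T ⟶ X) →₀ k) :
    genMap (gammaT T k) X u = 0 ↔
      ∀ ψ : X ⟶ irr T, straightPairing k (irrOrder T) ψ u = 0 := by
  constructor
  · intro h ψ
    have := pairing_genMap_gammaT (k := k) (opCorr ψ) u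
    rw [h, map_zero] at this
    exact this.symm
  · intro h
    refine pairing_injective _ fun φ => ?_
    obtain ⟨P, rfl⟩ := exists_act_irrIncl φ
    rw [pairing_genMap_gammaT, h]

lemma genMap_gammaGen_eq_zero_iff {X : FinCorr.{u}} (u : (irr T ⟶ X) →₀ k) :
    genMap (F := (gammaSub T k).toFunctor) (gammaGen T k) X u = 0 ↔
      genMap (gammaT T k) X u = 0 := by
  have h : (gammaSub T k).incl.app X
      (genMap (F := (gammaSub T k).toFunctor) (gammaGen T k) X u) = genMap (gammaT T k) X u :=
    app_genMap (gammaSub T k).incl (gammaGen T k) X u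
  constructor
  · intro h0
    rw [← h, h0, map_zero]
  · intro h0
    rw [← h] at h0
    exact Subtype.ext h0

lemma mem_perpLeft_gammaSub {X : FinCorr.{u}} (x : (FT k T).obj X) :
    x ∈ (perpLeft (gammaSub T k)).obj X ↔
      ∀ ψ : X ⟶ irr T, FT.coeff k (irrIncl T) ((FT k T).map ψ x) = 0 := by
  constructor
  · intro h ψ
    exact (pairing_map_gammaT (opCorr ψ) x).symm.trans (h _ (Submodule.subset_span ⟨_, rfl⟩))
  · intro h w hw
    have hle : (gammaSub T k).obj X ≤ LinearMap.ker (pairing k T X x) := by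
      refine Submodule.span_le.2 ?_
      rintro _ ⟨Q, rfl⟩
      exact (pairing_map_gammaT Q x).trans (h (opCorr Q))
    exact hle hw

lemma genMap_mem_perpLeft_gammaSub {X : FinCorr.{u}} (u : (irr T ⟶ X) →₀ k) :
    genMap (FT.of k (irrIncl T)) X u ∈ (perpLeft (gammaSub T k)).obj X ↔
      genMap (fundGen k (irrOrder T).op) X u = 0 := by
  rw [mem_perpLeft_gammaSub, genMap_fundGen_eq_zero_iff]
  exact forall_congr' fun ψ => by rw [coeff_map_genMap]

end Lattice

/-! ### Quotients and orthogonals -/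

section Perp

variable {k : Type v} [CommRing k]

lemma exists_quot_iso {F F' : CorrFunctor.{u} k} (θ : F ⟶ F')
    (hθ : ∀ X, Function.Surjective (θ.app X)) :
    ∃ i : (Sub.ker θ).quot ≅ F', (Sub.ker θ).proj ≫ i.hom = θ := by
  let f (X : FinCorr.{u}) : (F.obj X ⧸ LinearMap.ker (θ.app X).hom) →ₗ[k] F'.obj X :=
    (LinearMap.ker (θ.app X).hom).liftQ (θ.app X).hom le_rfl
  let η : (Sub.ker θ).quot ⟶ F' :=
    { app := fun X => ModuleCat.ofHom (f X)
      naturality := fun X Y Q => by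
        ext x
        obtain ⟨y, rfl⟩ := Submodule.mkQ_surjective _ x
        exact NatTrans.naturality_apply θ Q y }
  obtain ⟨i, hi⟩ := exists_iso_of_bijective η fun X => by
    refine ⟨?_, fun y => ?_⟩
    · exact LinearMap.ker_eq_bot.1 (Submodule.ker_liftQ_eq_bot _ _ _ le_rfl)
    · obtain ⟨x, rfl⟩ := hθ X y
      exact ⟨Submodule.mkQ _ x, rfl⟩
  refine ⟨i, ?_⟩
  rw [hi]
  rfl

/-- The dual of a quotient, as the orthogonal of the kernel under a perfect pairing. -/
lemma exists_perp_equiv_dual {M N S : Type*} [AddCommGroup M] [Module k M] [AddCommGroup N]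
    [Module k N] [AddCommGroup S] [Module k S] (B : M →ₗ[k] N →ₗ[k] k)
    (hinj : ∀ w, (∀ a, B a w = 0) → w = 0)
    (hsurj : ∀ f : M →ₗ[k] k, ∃ w, ∀ a, B a w = f a)
    (θ : M →ₗ[k] S) (hθ : Function.Surjective θ) (P : Submodule k N)
    (hP : ∀ w, w ∈ P ↔ ∀ a, θ a = 0 → B a w = 0) :
    ∃ e : P ≃ₗ[k] Module.Dual k S, ∀ w a, e w (θ a) = B a w := by
  have hex : ∀ w : P, ∃ f : Module.Dual k S, ∀ a, f (θ a) = B a w := by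
    intro w
    have hle : LinearMap.ker θ ≤ LinearMap.ker (B.flip w) := fun a ha => (hP _).1 w.2 a ha
    refine ⟨(LinearMap.ker θ).liftQ (B.flip w) hle ∘ₗ
      (θ.quotKerEquivOfSurjective hθ).symm.toLinearMap, fun a => ?_⟩
    have h : (θ.quotKerEquivOfSurjective hθ).symm (θ a) = (LinearMap.ker θ).mkQ a := by
      rw [LinearEquiv.symm_apply_eq]
      rfl
    change (LinearMap.ker θ).liftQ (B.flip w) hle
      ((θ.quotKerEquivOfSurjective hθ).symm (θ a)) = _
    rw [h]
    rfl
  choose f hf using hex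
  have hext : ∀ {g g' : Module.Dual k S}, (∀ a, g (θ a) = g' (θ a)) → g = g' := by
    intro g g' h
    refine LinearMap.ext fun s => ?_
    obtain ⟨a, rfl⟩ := hθ s
    exact h a
  let F : P →ₗ[k] Module.Dual k S :=
    { toFun := f
      map_add' := fun w w' => hext fun a => by simp [hf]
      map_smul' := fun c w => hext fun a => by simp [hf] }
  refine ⟨LinearEquiv.ofBijective F ⟨?_, fun α => ?_⟩, hf⟩
  · refine (injective_iff_map_eq_zero F).2 fun w hw => Subtype.ext (hinj _ fun a => ?_)
    rw [← hf]
    exact LinearMap.congr_fun hw (θ a)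
  -- The element representing `α ∘ θ` lies in `P` because this form vanishes on the kernel of `θ`.
  · obtain ⟨w, hw⟩ := hsurj (α ∘ₗ θ)
    refine ⟨⟨w, (hP w).2 fun a ha => ?_⟩, hext fun a => ?_⟩
    · rw [hw, LinearMap.comp_apply, ha, map_zero]
    · exact (hf _ a).trans (hw a)

/-- If `F` is a quotient of `F_T`, its dual is the orthogonal of the kernel. -/
lemma exists_perpRight_iso_dual {T : Type u} [Lattice T] [BoundedOrder T] [Finite T]
    {F : CorrFunctor.{u} k} (θ : FT k T ⟶ F) (hθ : ∀ X, Function.Surjective (θ.app X)) :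
    ∃ j : (perpRight (Sub.ker θ)).toFunctor ≅ dual F,
      ∀ (X : FinCorr.{u}) (w : (perpRight (Sub.ker θ)).obj X) (a : (FT k T).obj X),
        dualApply (j.hom.app X w) (θ.app X a) = pairing k T X a w.1 := by
  have h : ∀ X : FinCorr.{u}, ∃ e : (perpRight (Sub.ker θ)).obj X ≃ₗ[k] Module.Dual k (F.obj X),
      ∀ w a, e w (θ.app X a) = pairing k T X a w.1 := fun X =>
    exists_perp_equiv_dual (pairing k T X) (fun w hw => pairing_injective w fun φ => hw _)
      pairing_surjective (θ.app X).hom (hθ X) _ fun w => Iff.rfl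
  choose e he using h
  refine ⟨NatIso.ofComponents (fun X => (e X).toModuleIso) fun {X Y} Q => ?_, he⟩
  ext w
  refine LinearMap.ext fun s => ?_
  obtain ⟨a, rfl⟩ := hθ Y s
  change e Y ((perpRight (Sub.ker θ)).toFunctor.map Q w) (θ.app Y a) =
    e X w (F.map (opCorr Q) (θ.app Y a))
  have h1 : F.map (opCorr Q) (θ.app Y a) = θ.app X ((FT k T).map (opCorr Q) a) :=
    (NatTrans.naturality_apply θ (opCorr Q) a).symm
  rw [h1]
  exact (he Y _ a).trans ((pairing_map T k Q a w.1).trans (he X w _).symm)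

end Perp

end CorrFun

end

open CorrFun
theorem mainTheorem7 {k : Type v} [CommRing k] (T : Type u) [Lattice T] [BoundedOrder T]
    [Finite T] :
    ∃ Θ : FT k T ⟶ fundFunctor k (irrOrder T).op,
      (Θ.app (irr T) (FT.of k (irrIncl T)) = fundEval k (irrOrder T).op (fGen k (irrOrder T).op) ∧
        ∀ Θ' : FT k T ⟶ fundFunctor k (irrOrder T).op,
          Θ'.app (irr T) (FT.of k (irrIncl T)) =
            fundEval k (irrOrder T).op (fGen k (irrOrder T).op) → Θ' = Θ) ∧
      perpLeft (gammaSub T k) = Sub.ker Θ ∧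
      (∃ i : (perpLeft (gammaSub T k)).quot ≅ fundFunctor k (irrOrder T).op,
        (perpLeft (gammaSub T k)).proj ≫ i.hom = Θ) ∧
      ∃ j : (perpRight (perpLeft (gammaSub T k))).toFunctor ≅
          dual (fundFunctor k (irrOrder T).op),
        (∀ (X : FinCorr.{u}) (w : (perpRight (perpLeft (gammaSub T k))).obj X)
          (a : (FT k T).obj X), dualApply (j.hom.app X w) (Θ.app X a) = pairing k T X a w.1) ∧
        ∃ (β : fundFunctor k (irrOrder T) ≅ (gammaSub T k).toFunctor)
          (α : fundFunctor k (irrOrder T) ⟶ dual (fundFunctor k (irrOrder T).op)),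
          β.hom.app (irr T) (fundEval k (irrOrder T) (fGen k (irrOrder T))) = gammaGen T k ∧
          α = β.hom ≫ Sub.inclusion (le_perp_perp (gammaSub T k)) ≫ j.hom ∧
          (∀ X : FinCorr.{u}, Function.Injective (α.app X)) ∧
          IsCanonical k (irrOrder T) α ∧
          ∀ α' : fundFunctor k (irrOrder T) ⟶ dual (fundFunctor k (irrOrder T).op),
            IsCanonical k (irrOrder T) α' → α' = α := by
  have hgen : Generates (FT.of k (irrIncl T)) := generates_irrIncl
  obtain ⟨Θ, hΘ⟩ := hgen.exists_hom (fundGen k (irrOrder T).op) fun X u hu => by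
    rw [← genMap_mem_perpLeft_gammaSub, hu]
    exact Submodule.zero_mem _
  have hΘs := (generates_fundGen (k := k) (irrOrder T).op).surjective Θ _ hΘ
  have hker : perpLeft (gammaSub T k) = Sub.ker Θ := by
    ext X x
    obtain ⟨u, rfl⟩ := hgen X x
    refine genMap_mem_perpLeft_gammaSub u |>.trans ?_
    change _ ↔ Θ.app X _ = 0
    rw [app_genMap, hΘ]
  refine ⟨Θ, ⟨hΘ, fun Θ' hΘ' => hgen.hom_ext (hΘ'.trans hΘ.symm)⟩, hker, ?_, ?_⟩
  · rw [hker]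
    exact exists_quot_iso Θ hΘs
  have hj : ∃ j : (perpRight (perpLeft (gammaSub T k))).toFunctor ≅
      dual (fundFunctor k (irrOrder T).op),
      ∀ (X : FinCorr.{u}) (w : (perpRight (perpLeft (gammaSub T k))).obj X)
        (a : (FT k T).obj X), dualApply (j.hom.app X w) (Θ.app X a) = pairing k T X a w.1 := by
    rw [hker]
    exact exists_perpRight_iso_dual Θ hΘs
  obtain ⟨j, hj⟩ := hj
  obtain ⟨β, hβ⟩ := (generates_fundGen (k := k) (irrOrder T)).exists_iso
    (F' := (gammaSub T k).toFunctor) (g' := gammaGen T k) (generates_gen (gammaT T k))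
    fun X u => by
      rw [genMap_gammaGen_eq_zero_iff, genMap_gammaT_eq_zero_iff, genMap_fundGen_eq_zero_iff]
  have hcan : IsCanonical k (irrOrder T)
      (β.hom ≫ Sub.inclusion (le_perp_perp (gammaSub T k)) ≫ j.hom) := by
    intro σ
    -- Writing `Δ_σ f_{R^op}` as `Θ(Δ_σ ι)` lets `hj` evaluate the linear form as a pairing with
    -- `γ_T`.
    have h1 : fundEval k (irrOrder T).op
        (fundRep k (irrOrder T).op (permRel σ) (fGen k (irrOrder T).op)) =
          Θ.app (irr T) (FT.of k (act (permRel σ) (irrIncl T))) := by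
      rw [fundEval_fundRep, ← FT.map_of, ← hΘ]
      exact (NatTrans.naturality_apply Θ (permRel σ) _).symm
    have h2 : (β.hom ≫ Sub.inclusion (le_perp_perp (gammaSub T k)) ≫ j.hom).app (irr T)
        (fundEval k (irrOrder T) (fGen k (irrOrder T))) =
          j.hom.app (irr T) ((Sub.inclusion (le_perp_perp (gammaSub T k))).app (irr T)
            (gammaGen T k)) :=
      congrArg (fun x => j.hom.app (irr T)
        ((Sub.inclusion (le_perp_perp (gammaSub T k))).app (irr T) x)) hβ
    rw [h1, h2]
    refine (hj _ _ _).trans ((pairing_gammaT _).trans ((FT.coeff_of _ _).trans ?_))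
    have h3 := (act_irrIncl_eq_iff (permRel σ)).trans (straight_permRel_iff (irrOrder T).op σ)
    by_cases hσ : σ = 1
    · rw [if_pos hσ, if_pos (h3.2 hσ)]
    · rw [if_neg hσ, if_neg fun h => hσ (h3.1 h)]
  refine ⟨j, hj, β, _, hβ, rfl, fun X => ?_, hcan, fun α' hα' => ?_⟩
  · have h1 : Function.Injective (β.hom.app X) :=
      ((ConcreteCategory.isIso_iff_bijective (β.hom.app X)).1 inferInstance).1
    have h2 : Function.Injective (j.hom.app X) :=
      ((ConcreteCategory.isIso_iff_bijective (j.hom.app X)).1 inferInstance).1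
    exact h2.comp ((Submodule.inclusion_injective (le_perp_perp (gammaSub T k) X)).comp h1)
  -- A morphism out of `𝕊_{E,R}` is determined by the image of `f_R`, and a linear form on
  -- `𝕊_{E,R^op}(E)` by its values on the `Δ_σ f_{R^op}`.
  · exact (generates_fundGen (k := k) (irrOrder T)).hom_ext
      (dual_fundFunctor_ext _ fun σ => (hα' σ).trans (hcan σ).symm)
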